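/- Let $\Gamma$ be a finite tree with vertex set $V$ and an integer weight $w(v)$ on each vertex $v$, whose intersection matrix (diagonal entries $w(v)$, off-diagonal entries $1$ for neighbours and $0$ otherwise) is negative definite; $\langle\,,\rangle$ is the corresponding form on $\mathbb Z^V$, with standard basis $\{E_v\}_{v\in V}$. *Combinatorics.* Let $n(v)$ be the number of neighbours of $v$ and $d(v)=n(v)-|w(v)|$. The vertex $v$ is good if $d(v)\le 0$, bad if $d(v)\ge 1$, and very bad if $d(v)\ge 2$. The tree $\Gamma$ is *insulated* if it has no very bad vertex, every good vertex $v$ satisfies $d(v)+K(v)\le 0$, where $K(v)$ is the number of bad neighbours of $v$, and no two bad vertices are neighbours. $\Gamma$ *contains a proper $E_8$ subgraph* if some subgraph of $\Gamma$, not containing all vertices of $\Gamma$, is isomorphic to the $E_8$ graph and has all its weights equal to $-2$. *Lattice cohomology.* Let $\mathcal T^+=\mathbb Z[U,U^{-1}]/U\,\mathbb Z[U]$. For a characteristic functional $k:\mathbb Z^V\to\mathbb Z$ (one with $k(x)+\langle x,x\rangle$ even for all $x$) put $\chi_k(x)=-\tfrac12\bigl(k(x)+\langle x,x\rangle\bigr)$.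 For $l\in\mathbb Z^V$ and $I\subseteq V$ with $|I|=q$ let $(l,I)$ be the $q$-cube with vertices $l+\sum_{v\in J}E_v$, $J\subseteq I$, and let the weight $\chi_k(\square)$ of a cube be the maximum of $\chi_k$ over its vertices. Let $F^q$ be the $\mathbb Z[U]$-module of finitely supported functions from $q$-cubes to $\mathcal T^+$, with coboundary $$(\delta\varphi)(\square)=\sum_{\square'}\varepsilon_{\square'}\,U^{\chi_k(\square)-\chi_k(\square')}\varphi(\square'),$$ where $\partial\square=\sum\varepsilon_{\square'}\square'$ is the oriented cubical boundary. The reduced lattice cohomology $\mathbb H^q_{red}(\Gamma,k)$, $q\ge 0$, is the cohomology of the augmented complex $0\to\mathcal T^+\to F^0\to F^1\to\cdots$ whose augmentation sends $t$ to $l\mapsto U^{\chi_k(l)-\min\chi_k}\,t$. Up to isomorphism and grading shift it depends only on the class of $k$ modulo $\{2\langle l,\cdot\rangle: l\in\mathbb Z^V\}$, that is, on the corresponding $Spin^c$ structure of the plumbed $3$-manifold. $\Gamma$ is a *lattice cohomology $L$-space* if $\mathbb H^q_{red}(\Gamma,k)=0$ for all characteristic $k$ and all $q\ge 0$, i.e.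 if $\mathbb H_{red}$ vanishes for all $Spin^c$ structures. **Proposition.** For every such negative-definite plumbing tree $\Gamma$: 1. If $\Gamma$ has a very bad vertex, then $\Gamma$ is not a lattice cohomology $L$-space. 2. If $\Gamma$ contains a proper $E_8$ subgraph, then $\Gamma$ is not a lattice cohomology $L$-space. 3. If $\Gamma$ is insulated, then $\Gamma$ is a lattice cohomology $L$-space. -/

import Mathlib

open scoped Polynomial

/-! ## The module `𝒯⁺` -/

/-- Multiplication by `U` on `𝒯⁺`.  The finitely supported function `f : ℕ →₀ ℤ` stands for
`∑ d, f d • U⁻ᵈ`, so that `U` maps `U⁻⁽ᵈ⁺¹⁾` to `U⁻ᵈ` and `U⁰` to `0`. -/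
noncomputable def towerU : (ℕ →₀ ℤ) →ₗ[ℤ] (ℕ →₀ ℤ) :=
  Finsupp.lcomapDomain Nat.succ Nat.succ_injective

/-- The `ℤ[U]`-module `𝒯⁺ = ℤ[U, U⁻¹] / U ℤ[U]`: the free abelian group on `U⁻ᵈ`, `d ≥ 0`, with the
polynomial variable acting as `towerU`. -/
abbrev TPlus : Type := Module.AEval' towerU

/-! ## Lattice cohomology of a weight function on `ℤ^V` -/

/-- The `q`-cube of `ℝ^V` with vertices `base + ∑ v ∈ J, E_v`, `J ⊆ dirs`. -/
@[ext]
structure LatticeCube (V : Type*) (q : ℕ) where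
  base : V → ℤ
  dirs : Finset V
  card_dirs : dirs.card = q

namespace LatticeCube

variable {V : Type*} [LinearOrder V] {q : ℕ}

/-- The weight of a cube: the maximum of `w` on its vertices. -/
def weight (w : (V → ℤ) → ℤ) (c : LatticeCube V q) : ℤ :=
  c.dirs.powerset.sup' ⟨∅, Finset.empty_mem_powerset _⟩
    (fun J => w (c.base + ∑ v ∈ J, Pi.single v 1))

/-- The face of a cube in direction `v` through its base point. -/
def lowerFace (c : LatticeCube V (q + 1)) (v : V) (hv : v ∈ c.dirs) : LatticeCube V q where
  base := c.base
  dirs := c.dirs.erase v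
  card_dirs := by rw [Finset.card_erase_of_mem hv, c.card_dirs, Nat.add_sub_cancel]

/-- The opposite face in direction `v`. -/
def upperFace (c : LatticeCube V (q + 1)) (v : V) (hv : v ∈ c.dirs) : LatticeCube V q where
  base := c.base + Pi.single v 1
  dirs := c.dirs.erase v
  card_dirs := by rw [Finset.card_erase_of_mem hv, c.card_dirs, Nat.add_sub_cancel]

/-- The sign with which direction `v` enters the boundary of a cube, the directions of a cube being
listed in increasing order. -/
noncomputable def sign (c : LatticeCube V q) (v : V) : ℤ[X] :=
  (-1) ^ (c.dirs.filter (fun u => u < v)).card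

/-- The set of cubes with a face in a finite set of cubes is finite. -/
theorem finite_cofaces [Fintype V] (s : Set (LatticeCube V q)) (hs : s.Finite) :
    {c : LatticeCube V (q + 1) | ∃ v, ∃ hv : v ∈ c.dirs,
      c.lowerFace v hv ∈ s ∨ c.upperFace v hv ∈ s}.Finite := by
  have key : ∀ (d : LatticeCube V q) (v : V),
      {c : LatticeCube V (q + 1) | ∃ hv : v ∈ c.dirs,
        c.lowerFace v hv = d ∨ c.upperFace v hv = d}.Finite := by
    intro d v
    have h1 : {c : LatticeCube V (q + 1) | ∃ hv : v ∈ c.dirs, c.lowerFace v hv = d}.Finite := by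
      apply Set.Subsingleton.finite
      rintro c ⟨hv, rfl⟩ c' ⟨hv', h⟩
      simp only [lowerFace, LatticeCube.mk.injEq] at h
      ext1
      · exact h.1.symm
      · rw [← Finset.insert_erase hv, ← Finset.insert_erase hv', h.2]
    have h2 : {c : LatticeCube V (q + 1) | ∃ hv : v ∈ c.dirs, c.upperFace v hv = d}.Finite := by
      apply Set.Subsingleton.finite
      rintro c ⟨hv, rfl⟩ c' ⟨hv', h⟩
      simp only [upperFace, LatticeCube.mk.injEq, add_left_inj] at h
      ext1
      · exact h.1.symm
      · rw [← Finset.insert_erase hv, ← Finset.insert_erase hv', h.2]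
    refine (h1.union h2).subset ?_
    rintro c ⟨hv, h | h⟩
    exacts [Or.inl ⟨hv, h⟩, Or.inr ⟨hv, h⟩]
  refine (hs.biUnion fun d _ => Set.finite_iUnion (key d)).subset ?_
  rintro c ⟨v, hv, h | h⟩
  · exact Set.mem_biUnion h (Set.mem_iUnion.2 ⟨v, hv, Or.inl rfl⟩)
  · exact Set.mem_biUnion h (Set.mem_iUnion.2 ⟨v, hv, Or.inr rfl⟩)

end LatticeCube

namespace LatticeCohomology

variable {V : Type*} [Fintype V] [LinearOrder V]

/-- The lattice `q`-cochains `F^q`: finitely supported functions from `q`-cubes to `𝒯⁺`. -/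
abbrev Cochain (V : Type*) (q : ℕ) : Type _ := LatticeCube V q →₀ TPlus

/-- The value `∑ ± U ^ (w(□) - w(□')) φ(□')` of the coboundary of `φ` on the cube `□ = c`, the sum
being over the codimension-one faces `□'` of `□`.  All exponents are nonnegative. -/
noncomputable def coboundaryFun (w : (V → ℤ) → ℤ) {q : ℕ} (φ : Cochain V q)
    (c : LatticeCube V (q + 1)) : TPlus :=
  ∑ v : c.dirs, c.sign v •
    ((Polynomial.X : ℤ[X]) ^ (c.weight w - (c.upperFace v v.2).weight w).toNat •
        φ (c.upperFace v v.2)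
      - (Polynomial.X : ℤ[X]) ^ (c.weight w - (c.lowerFace v v.2).weight w).toNat •
        φ (c.lowerFace v v.2))

theorem coboundaryFun_finite (w : (V → ℤ) → ℤ) {q : ℕ} (φ : Cochain V q) :
    (Function.support (coboundaryFun w φ)).Finite := by
  refine (LatticeCube.finite_cofaces _ φ.hasFiniteSupport).subset ?_
  intro c hc
  by_contra hcon
  apply hc
  refine Finset.sum_eq_zero fun v _ => ?_
  simp only [Set.mem_ofPred_eq, not_exists, not_or, Function.mem_support, not_not] at hcon
  rw [(hcon v v.2).1, (hcon v v.2).2]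
  simp

/-- The coboundary operator `δ_w : F^q → F^{q+1}`. -/
noncomputable def coboundary (w : (V → ℤ) → ℤ) (q : ℕ) :
    Cochain V q →ₗ[ℤ[X]] Cochain V (q + 1) where
  toFun φ := Finsupp.ofSupportFinite (coboundaryFun w φ) (coboundaryFun_finite w φ)
  map_add' φ ψ := by
    ext1 c
    simp only [Finsupp.ofSupportFinite_coe, Finsupp.add_apply, coboundaryFun,
      ← Finset.sum_add_distrib]
    refine Finset.sum_congr rfl fun v _ => ?_
    rw [smul_add, smul_add, add_sub_add_comm, smul_add]
  map_smul' a φ := by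
    ext1 c
    simp only [Finsupp.ofSupportFinite_coe, Finsupp.smul_apply, coboundaryFun, RingHom.id_apply,
      Finset.smul_sum]
    refine Finset.sum_congr rfl fun v _ => ?_
    simp only [smul_comm a, smul_sub]

/-- The image in `F^0` of the augmentation `𝒯⁺ → F^0`, `t ↦ (l ↦ U ^ (w(l) - min w) t)`. -/
noncomputable def augmentationImage (w : (V → ℤ) → ℤ) : Submodule ℤ[X] (Cochain V 0) where
  carrier := {φ | ∃ t : TPlus, ∀ c : LatticeCube V 0,
    φ c = (Polynomial.X : ℤ[X]) ^ (w c.base - ⨅ l, w l).toNat • t}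
  zero_mem' := ⟨0, fun c => by simp⟩
  add_mem' := by
    rintro φ ψ ⟨s, hs⟩ ⟨t, ht⟩
    exact ⟨s + t, fun c => by rw [Finsupp.add_apply, hs, ht, smul_add]⟩
  smul_mem' := by
    rintro a φ ⟨t, ht⟩
    exact ⟨a • t, fun c => by rw [Finsupp.smul_apply, ht, smul_comm]⟩

/-- The coboundaries of the augmented complex `0 → 𝒯⁺ → F^0 → F^1 → ⋯` in degree `q`. -/
noncomputable def augmentedCoboundaries (w : (V → ℤ) → ℤ) :
    (q : ℕ) → Submodule ℤ[X] (Cochain V q)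
  | 0 => augmentationImage w
  | q + 1 => LinearMap.range (coboundary w q)

/-- Reduced lattice cohomology `ℍ^q_red` of the weight function `w`, as a `ℤ[U]`-module: the `q`-th
cohomology of the augmented complex `0 → 𝒯⁺ → F^0 → F^1 → ⋯`.  Thus `ℍ^q_red = ℍ^q` for `q ≥ 1`, and
`ℍ^0_red` is the quotient of `ℍ^0 = ker (F^0 → F^1)` by the canonical copy of `𝒯⁺`. -/
abbrev Reduced (w : (V → ℤ) → ℤ) (q : ℕ) : Type _ :=
  LinearMap.ker (coboundary w q) ⧸
    (augmentedCoboundaries w q).submoduleOf (LinearMap.ker (coboundary w q))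

end LatticeCohomology

/-! ## Plumbing trees -/

/-- A tree with integer weights on its vertices (all genera are zero). -/
structure PlumbingTree (V : Type*) where
  graph : SimpleGraph V
  isTree : graph.IsTree
  weight : V → ℤ

namespace PlumbingTree

variable {V : Type*}

open Classical in
/-- The intersection matrix. -/
noncomputable def intersectionMatrix (Γ : PlumbingTree V) : Matrix V V ℤ :=
  Matrix.of fun u v => if u = v then Γ.weight u else if Γ.graph.Adj u v then 1 else 0

/-- The intersection matrix is negative definite (over `ℝ`). -/
def NegativeDefinite (Γ : PlumbingTree V) : Prop :=
  (-(Γ.intersectionMatrix.map (Int.cast : ℤ → ℝ))).PosDef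

/-- The intersection form on `ℤ^V`. -/
noncomputable def form [Fintype V] (Γ : PlumbingTree V) (x y : V → ℤ) : ℤ :=
  x ⬝ᵥ (Γ.intersectionMatrix.mulVec y)

/-- Characteristic functionals on `ℤ^V`.  Every `Spin^c` structure of the plumbed manifold is the class
of such a `k`, and `k` and `k'` have the same class iff `k' - k = 2⟨l, ·⟩` for some `l ∈ ℤ^V`. -/
def IsCharacteristic [Fintype V] (Γ : PlumbingTree V) (k : (V → ℤ) →ₗ[ℤ] ℤ) : Prop :=
  ∀ x, Even (k x + Γ.form x x)

/-- The weight function `χ_k(x) = -(k(x) + ⟨x, x⟩) / 2`; the division is exact for characteristic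
`k`. -/
noncomputable def chi [Fintype V] (Γ : PlumbingTree V) (k : (V → ℤ) →ₗ[ℤ] ℤ) (x : V → ℤ) : ℤ :=
  -((k x + Γ.form x x) / 2)

/-- `Γ` is a lattice cohomology L-space: `ℍ_red(Γ, 𝔱) = 0` for every `Spin^c` structure `𝔱`.  Up to
isomorphism and a shift of the grading `ℍ_red(Γ, k)` depends only on the class of `k`, so `k` runs
over all representatives.  The order on `V` only serves to orient cubes. -/
def IsLatticeLSpace [Fintype V] [LinearOrder V] (Γ : PlumbingTree V) : Prop :=
  ∀ k : (V → ℤ) →ₗ[ℤ] ℤ, Γ.IsCharacteristic k →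
    ∀ q : ℕ, Subsingleton (LatticeCohomology.Reduced (Γ.chi k) q)

/-- The deficiency `d(v) = n(v) - |w(v)|`, with `n(v)` the number of neighbours of `v`. -/
noncomputable def deficiency (Γ : PlumbingTree V) (v : V) : ℤ :=
  (Γ.graph.neighborSet v).ncard - |Γ.weight v|

def IsGood (Γ : PlumbingTree V) (v : V) : Prop := Γ.deficiency v ≤ 0

def IsBad (Γ : PlumbingTree V) (v : V) : Prop := 1 ≤ Γ.deficiency v

def IsVeryBad (Γ : PlumbingTree V) (v : V) : Prop := 2 ≤ Γ.deficiency v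

/-- The number of bad neighbours of `v`. -/
noncomputable def badNeighbours (Γ : PlumbingTree V) (v : V) : ℕ :=
  {u | Γ.graph.Adj v u ∧ Γ.IsBad u}.ncard

/-- Insulated plumbing trees. -/
structure IsInsulated (Γ : PlumbingTree V) : Prop where
  negativeDefinite : Γ.NegativeDefinite
  not_veryBad : ∀ v, ¬ Γ.IsVeryBad v
  good : ∀ v, Γ.IsGood v → Γ.deficiency v + Γ.badNeighbours v ≤ 0
  bad : ∀ u v, Γ.IsBad u → Γ.IsBad v → ¬ Γ.graph.Adj u v

/-- The `E₈` graph: the chain `0 - 1 - 2 - 3 - 4 - 5 - 6` with a further leaf `7` attached to `4`. -/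
def e8Graph : SimpleGraph (Fin 8) :=
  SimpleGraph.fromEdgeSet {s(0, 1), s(1, 2), s(2, 3), s(3, 4), s(4, 5), s(5, 6), s(4, 7)}

/-- `Γ` contains a proper (negative-definite) `E₈` subgraph: a copy of the `E₈` graph, all of whose
vertices have weight `-2` in `Γ`, that does not exhaust `Γ`. -/
def ContainsProperE8 (Γ : PlumbingTree V) : Prop :=
  ∃ f : e8Graph →g Γ.graph, Function.Injective f ∧ (∀ i, Γ.weight (f i) = -2) ∧
    ¬ Function.Surjective f

end PlumbingTree

/-!
The lattice cochains split by level into the cellular cochains of the sublevel sets `{χ_k ≤ n}`,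
which are unions of cubes, so that `Γ` is an L-space exactly if all nonempty sublevel sets of all
`χ_k` have vanishing reduced cohomology. The proposition rests on
rationality, the condition that `χ_K(x) ≥ 1` for the canonical functional `K` and all nonzero
effective cycles `x`.

If `χ_K(x) ≤ 0` for some nonzero `x ≥ 0`, then `{χ_K ≤ 0}` is disconnected: it contains `0` and `x`,
but no edge of it leaves the orthant `{l ≤ 0}`, because `χ_K(-b) ≥ 0` for `b ≥ 0` and
`χ_K(E_v) = 1` (`NegativeDefinite.not_isLatticeLSpace`). Such an `x` is `∑ u, E_u + E_v` for a very
bad vertex `v`, and `Z + E_u` for the fundamental cycle `Z` of a proper `E₈` subgraph and a vertex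
`u` attached to it, all multiplicities of `Z` being at least two.

If `Γ` is insulated, then the cycle `Z` with multiplicity two at the bad and one at the good
vertices is anti-nef, `χ_K ≥ 1` on the nonzero cycles between `0` and `Z`, and rationality follows
by splitting `x` into `min(x, Z)` and `(x - Z)⁺` (`IsInsulated.one_le_chi_canonical`).

Let `Γ` be rational and `k` characteristic. Choose `p` minimal among the lattice points such that
`χ_k(p) < χ_k(p + E_v)` for all `v`. By rationality every `a > 0` has a component `E_v` with
`χ_k(p + a - E_v) ≤ χ_k(p + a)`, and by minimality every `b > 0` has one with
`χ_k(p - b + E_v) ≤ χ_k(p - b)`. As the off-diagonal entries of the intersection matrix are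
nonnegative, it follows that any box around `p` is built from `p` by adding layers of lattice points
whose projection to the previous box does not increase `χ_k` (`Collapses`, `exists_collapses`).
Adding such a layer does not change the cohomology of sublevel sets (`BoxAcyclic.add_layer`), and
cochains of bounded level live on a bounded set, so the augmented complex is exact
(`subsingleton_reduced_of_collapses`). For the cubical computations cochains are replaced by
functions of a base point and a set of directions, defined on the cubes of all dimensions at once.
-/

/-! ### Cubes, their vertices and their weights -/

namespace LatticeCohomology

section Cubes

variable {V : Type*} [LinearOrder V]

/-- The top vertex of the cube with base point `x` and set of directions `I`. -/
def cubeTop (x : V → ℤ) (I : Finset V) : V → ℤ :=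
  x + ∑ v ∈ I, Pi.single v 1

theorem cubeTop_apply (x : V → ℤ) (I : Finset V) (u : V) :
    cubeTop x I u = x u + if u ∈ I then 1 else 0 := by
  simp [cubeTop, Finset.sum_apply, Pi.single_apply]

/-- The weight of the cube with base point `x` and set of directions `I`. -/
def cubeWeight (w : (V → ℤ) → ℤ) (x : V → ℤ) (I : Finset V) : ℤ :=
  I.powerset.sup' I.powerset_nonempty (fun J => w (cubeTop x J))

/-- The vertices of a cube are the lattice points between its base point and its top. -/
theorem cubeWeight_le_iff {w : (V → ℤ) → ℤ} {x : V → ℤ} {I : Finset V} {m : ℤ} :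
    cubeWeight w x I ≤ m ↔ ∀ l ∈ Set.Icc x (cubeTop x I), w l ≤ m := by
  rw [cubeWeight, Finset.sup'_le_iff]
  constructor
  · rintro h l ⟨h1, h2⟩
    have hl : l = cubeTop x (I.filter fun u => l u = x u + 1) := by
      ext u
      have h1 := h1 u
      have h2 := h2 u
      rw [cubeTop_apply] at h2 ⊢
      simp only [Finset.mem_filter]
      split_ifs at h2 ⊢ <;> grind
    rw [hl]
    exact h _ (Finset.mem_powerset.2 (Finset.filter_subset _ _))
  · intro h J hJ
    rw [Finset.mem_powerset] at hJ
    refine h _ ⟨fun u => ?_, fun u => ?_⟩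
    · rw [cubeTop_apply]; split_ifs <;> simp
    · rw [cubeTop_apply, cubeTop_apply]
      have := @hJ u
      split_ifs <;> grind

theorem le_cubeWeight (w : (V → ℤ) → ℤ) {x l : V → ℤ} {I : Finset V}
    (h : l ∈ Set.Icc x (cubeTop x I)) : w l ≤ cubeWeight w x I :=
  cubeWeight_le_iff.1 le_rfl l h

theorem le_cubeTop (x : V → ℤ) (I : Finset V) : x ≤ cubeTop x I := fun u => by
  rw [cubeTop_apply]; split_ifs <;> simp

theorem cubeWeight_empty (w : (V → ℤ) → ℤ) (x : V → ℤ) : cubeWeight w x ∅ = w x := by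
  simp [cubeWeight, cubeTop]

/-- The displacement of the base point when passing to the face of a cube in direction `v` that
contains its base point (`b = false`) or to the opposite face (`b = true`). -/
def faceShift (b : Bool) (v : V) : V → ℤ := Pi.single v (if b then 1 else 0)

theorem faceShift_apply (b : Bool) (v u : V) :
    faceShift b v u = if u = v then (if b then 1 else 0) else 0 := by
  simp [faceShift, Pi.single_apply]

theorem Icc_face_subset {x : V → ℤ} {I : Finset V} {v : V} (hv : v ∈ I) (b : Bool) :
    Set.Icc (x + faceShift b v) (cubeTop (x + faceShift b v) (I.erase v)) ⊆
      Set.Icc x (cubeTop x I) := by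
  rintro l ⟨h1, h2⟩
  refine ⟨fun u => ?_, fun u => ?_⟩
  · have := h1 u
    simp only [Pi.add_apply, faceShift_apply] at this
    grind
  · have := h2 u
    simp only [cubeTop_apply, Pi.add_apply, faceShift_apply, Finset.mem_erase] at this ⊢
    grind

theorem cubeWeight_face_le (w : (V → ℤ) → ℤ) (x : V → ℤ) {I : Finset V} {v : V} (hv : v ∈ I)
    (b : Bool) : cubeWeight w (x + faceShift b v) (I.erase v) ≤ cubeWeight w x I :=
  cubeWeight_le_iff.2 fun _ hl => le_cubeWeight w (Icc_face_subset hv b hl)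

/-! ### The coboundary operator on arbitrary functions -/

variable {M : Type*} [AddCommGroup M] [Module ℤ[X] M]

/-- The incidence number of a cube with directions `I` and its face in direction `v` on the
side `b`. -/
noncomputable def incidence (I : Finset V) (v : V) (b : Bool) : ℤ[X] :=
  (-1) ^ (I.filter (fun u => u < v)).card * (if b then 1 else -1)

theorem incidence_mul_self (I : Finset V) (v : V) (b : Bool) :
    incidence I v b * incidence I v b = 1 := by
  have h := Even.neg_one_pow (α := ℤ[X]) (Even.add_self (I.filter (fun u => u < v)).card)
  rw [pow_add] at h
  cases b <;> simp [incidence, h]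

theorem incidence_anticomm {I : Finset V} {u v : V} (hu : u ∈ I) (huv : u < v) (b c : Bool) :
    incidence I v b * incidence (I.erase v) u c + incidence I u c * incidence (I.erase u) v b
      = 0 := by
  have h1 : (I.erase v).filter (fun t => t < u) = I.filter (fun t => t < u) := by
    ext t; simp only [Finset.mem_filter, Finset.mem_erase]; grind
  have h2 : (I.erase u).filter (fun t => t < v) = (I.filter (fun t => t < v)).erase u := by
    ext t; simp only [Finset.mem_filter, Finset.mem_erase]; grind
  have h3 : ((I.filter (fun t => t < v)).erase u).card + 1 = (I.filter (fun t => t < v)).card :=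
    Finset.card_erase_add_one (by simp [hu, huv])
  unfold incidence
  rw [h1, h2, ← h3, pow_succ]
  ring

/-- The coboundary of a function on the set of all cubes of all dimensions, a cube being encoded by
its base point and its set of directions. -/
noncomputable def delta (w : (V → ℤ) → ℤ) (Φ : (V → ℤ) → Finset V → M) (x : V → ℤ)
    (I : Finset V) : M :=
  ∑ v ∈ I, ∑ b : Bool, incidence I v b •
    (Polynomial.X : ℤ[X]) ^
      (cubeWeight w x I - cubeWeight w (x + faceShift b v) (I.erase v)).toNat •
        Φ (x + faceShift b v) (I.erase v)

@[simp]
theorem delta_empty (w : (V → ℤ) → ℤ) (Φ : (V → ℤ) → Finset V → M) (x : V → ℤ) :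
    delta w Φ x ∅ = 0 := by
  simp [delta]

theorem delta_sub (w : (V → ℤ) → ℤ) (Φ Ψ : (V → ℤ) → Finset V → M) (x : V → ℤ) (I : Finset V) :
    delta w (fun y J => Φ y J - Ψ y J) x I = delta w Φ x I - delta w Ψ x I := by
  simp only [delta, smul_sub, Finset.sum_sub_distrib]

theorem delta_add (w : (V → ℤ) → ℤ) (Φ Ψ : (V → ℤ) → Finset V → M) (x : V → ℤ) (I : Finset V) :
    delta w (fun y J => Φ y J + Ψ y J) x I = delta w Φ x I + delta w Ψ x I := by
  simp only [delta, smul_add, Finset.sum_add_distrib]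

theorem delta_delta (w : (V → ℤ) → ℤ) (Φ : (V → ℤ) → Finset V → M) (x : V → ℤ) (I : Finset V) :
    delta w (delta w Φ) x I = 0 := by
  -- the contribution of the codimension-two faces obtained in direction `v` first, then `u`
  set f : V × V → M := fun p => ∑ b : Bool, ∑ c : Bool,
    (incidence I p.1 b * incidence (I.erase p.1) p.2 c) •
      (Polynomial.X : ℤ[X]) ^ (cubeWeight w x I - cubeWeight w
        (x + faceShift b p.1 + faceShift c p.2) ((I.erase p.1).erase p.2)).toNat •
          Φ (x + faceShift b p.1 + faceShift c p.2) ((I.erase p.1).erase p.2) with hf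
  have key : delta w (delta w Φ) x I = ∑ p ∈ I.offDiag, f p := by
    rw [Finset.sum_finset_product' (f := fun v u => f (v, u)) I.offDiag I (fun v => I.erase v)
      (by intro p; simp only [Finset.mem_offDiag, Finset.mem_erase]; grind)]
    unfold delta
    refine Finset.sum_congr rfl fun v hv => ?_
    simp only [hf, Finset.smul_sum]
    rw [Finset.sum_comm]
    refine Finset.sum_congr rfl fun u hu => ?_
    refine Finset.sum_congr rfl fun b _ => Finset.sum_congr rfl fun c _ => ?_
    rw [smul_comm (_ ^ _) (incidence (I.erase v) u c), smul_smul,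
      smul_smul (Polynomial.X ^ _), ← pow_add]
    congr 3
    have h1 := cubeWeight_face_le w x hv b
    have h2 := cubeWeight_face_le w (x + faceShift b v) hu c
    omega
  have anti : ∀ u v, u ∈ I → v ∈ I → u < v → f (v, u) + f (u, v) = 0 := by
    intro u v hu hv huv
    simp only [hf]
    rw [Finset.sum_comm (f := fun b c => (incidence I u b * incidence (I.erase u) v c) • _),
      ← Finset.sum_add_distrib]
    refine Finset.sum_eq_zero fun b _ => ?_
    rw [← Finset.sum_add_distrib]
    refine Finset.sum_eq_zero fun c _ => ?_
    rw [Finset.erase_right_comm, add_right_comm x (faceShift c u), ← add_smul,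
      incidence_anticomm hu huv, zero_smul]
  rw [key]
  refine Finset.sum_involution (fun p _ => p.swap) ?_ ?_ ?_ ?_
  · rintro ⟨v, u⟩ hp
    simp only [Finset.mem_offDiag] at hp
    rcases lt_or_gt_of_ne hp.2.2 with h | h
    · rw [add_comm]; exact anti v u hp.1 hp.2.1 h
    · exact anti u v hp.2.1 hp.1 h
  · rintro ⟨v, u⟩ hp _ h
    simp only [Finset.mem_offDiag] at hp
    simp only [Prod.swap_prod_mk, Prod.mk.injEq] at h
    exact hp.2.2 h.2
  · rintro ⟨v, u⟩ hp
    simp only [Finset.mem_offDiag] at hp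
    simp [hp.1, hp.2.1, hp.2.2.symm]
  · rintro ⟨v, u⟩ _
    rfl

/-- If `Φ` vanishes on all facets of a cube but one, and the remaining facet has the weight of the
cube, then only that facet contributes to the coboundary. -/
theorem delta_eq_of_forall_facet_eq_zero {w : (V → ℤ) → ℤ} {Φ : (V → ℤ) → Finset V → M}
    {x : V → ℤ} {I : Finset V} {v : V} (hv : v ∈ I) (b : Bool)
    (hw : cubeWeight w (x + faceShift b v) (I.erase v) = cubeWeight w x I)
    (h : ∀ u ∈ I, ∀ c, (u, c) ≠ (v, b) → Φ (x + faceShift c u) (I.erase u) = 0) :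
    delta w Φ x I = incidence I v b • Φ (x + faceShift b v) (I.erase v) := by
  unfold delta
  rw [Finset.sum_eq_single_of_mem v hv, Finset.sum_eq_single_of_mem b (Finset.mem_univ _)]
  · rw [hw, sub_self, Int.toNat_zero, pow_zero, one_smul]
  · intro c _ hc
    rw [h v hv c (by simpa using hc), smul_zero, smul_zero]
  · intro u hu huv
    refine Finset.sum_eq_zero fun c _ => ?_
    rw [h u hu c (by simp [huv]), smul_zero, smul_zero]

/-! ### Cochains of bounded level -/

/-- `Φ` has level at most `N`: the value of `Φ` on a cube of weight `m` is annihilated by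
`U ^ (N + 1 - m)`.  For coefficients `𝒯⁺` these are the cochains of the sublevel sets of `w` at
heights up to `N`. -/
def LevelLE (w : (V → ℤ) → ℤ) (N : ℤ) (Φ : (V → ℤ) → Finset V → M) : Prop :=
  ∀ x I, (Polynomial.X : ℤ[X]) ^ (N + 1 - cubeWeight w x I).toNat • Φ x I = 0

theorem X_pow_smul_eq_zero_of_le {m n : ℕ} (h : m ≤ n) {t : M}
    (ht : (Polynomial.X : ℤ[X]) ^ m • t = 0) : (Polynomial.X : ℤ[X]) ^ n • t = 0 := by
  rw [← Nat.sub_add_cancel h, pow_add, mul_smul, ht, smul_zero]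

theorem LevelLE.sub {w : (V → ℤ) → ℤ} {N : ℤ} {Φ Ψ : (V → ℤ) → Finset V → M}
    (hΦ : LevelLE w N Φ) (hΨ : LevelLE w N Ψ) : LevelLE w N (fun x I => Φ x I - Ψ x I) := by
  intro x I
  rw [smul_sub, hΦ, hΨ, sub_zero]

theorem LevelLE.add {w : (V → ℤ) → ℤ} {N : ℤ} {Φ Ψ : (V → ℤ) → Finset V → M}
    (hΦ : LevelLE w N Φ) (hΨ : LevelLE w N Ψ) : LevelLE w N (fun x I => Φ x I + Ψ x I) := by
  intro x I
  rw [smul_add, hΦ, hΨ, add_zero]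

theorem LevelLE.delta {w : (V → ℤ) → ℤ} {N : ℤ} {Φ : (V → ℤ) → Finset V → M}
    (hΦ : LevelLE w N Φ) : LevelLE w N (delta w Φ) := by
  intro x I
  simp only [LatticeCohomology.delta, Finset.smul_sum]
  refine Finset.sum_eq_zero fun v hv => Finset.sum_eq_zero fun b _ => ?_
  rw [smul_comm, smul_smul (_ ^ _), ← pow_add]
  have := cubeWeight_face_le w x hv b
  rw [X_pow_smul_eq_zero_of_le (by omega) (hΦ _ _), smul_zero]

theorem LevelLE.eq_zero {w : (V → ℤ) → ℤ} {N : ℤ} {Φ : (V → ℤ) → Finset V → M}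
    (hΦ : LevelLE w N Φ) {x : V → ℤ} {I : Finset V} (h : N < cubeWeight w x I) : Φ x I = 0 := by
  have := hΦ x I
  rwa [Int.toNat_of_nonpos (by omega), pow_zero, one_smul] at this

/-- The augmentation of `t`, extended by zero to cubes of positive dimension; `m` is the minimum of
the weight function. -/
noncomputable def augment (w : (V → ℤ) → ℤ) (m : ℤ) (t : M) (x : V → ℤ) (I : Finset V) : M :=
  if I = ∅ then (Polynomial.X : ℤ[X]) ^ (w x - m).toNat • t else 0

theorem delta_augment {w : (V → ℤ) → ℤ} {m : ℤ} (hm : ∀ x, m ≤ w x) (t : M) (x : V → ℤ)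
    (I : Finset V) : delta w (augment w m t) x I = 0 := by
  refine Finset.sum_eq_zero fun v hv => ?_
  by_cases hI : I.erase v = ∅
  · have hW : ∀ b, cubeWeight w (x + faceShift b v) (I.erase v) = w (x + faceShift b v) := by
      intro b; rw [hI, cubeWeight_empty]
    have hX : ∀ b : Bool, (Polynomial.X : ℤ[X]) ^ (cubeWeight w x I -
        cubeWeight w (x + faceShift b v) (I.erase v)).toNat •
          augment w m t (x + faceShift b v) (I.erase v)
        = (Polynomial.X : ℤ[X]) ^ (cubeWeight w x I - m).toNat • t := by
      intro b
      have h1 := cubeWeight_face_le w x hv b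
      have h2 := hm (x + faceShift b v)
      rw [augment, if_pos hI, smul_smul, ← pow_add]
      rw [hW] at h1 ⊢
      congr 2
      omega
    simp only [hX, ← Finset.sum_smul]
    simp [incidence]
  · refine Finset.sum_eq_zero fun b _ => ?_
    rw [augment, if_neg hI, smul_zero, smul_zero]

theorem levelLE_augment {w : (V → ℤ) → ℤ} {m N : ℤ} (hm : ∀ x, m ≤ w x) {t : M}
    (ht : (Polynomial.X : ℤ[X]) ^ (N + 1 - m).toNat • t = 0) : LevelLE w N (augment w m t) := by
  intro x I
  by_cases hI : I = ∅
  · subst hI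
    rw [augment, if_pos rfl, smul_smul, ← pow_add, cubeWeight_empty]
    have := hm x
    exact X_pow_smul_eq_zero_of_le (by omega) ht
  · rw [augment, if_neg hI, smul_zero]

/-! ### Collapsing boxes -/

/-- The cube with base point `x` and directions `I` lies in the box from `lo` to `hi`. -/
def InBox (lo hi x : V → ℤ) (I : Finset V) : Prop := lo ≤ x ∧ cubeTop x I ≤ hi

theorem InBox.face {lo hi x : V → ℤ} {I : Finset V} (h : InBox lo hi x I) {v : V} (hv : v ∈ I)
    (b : Bool) : InBox lo hi (x + faceShift b v) (I.erase v) := by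
  have hs := Icc_face_subset (x := x) hv b
  exact ⟨h.1.trans (hs ⟨le_rfl, le_cubeTop _ _⟩).1, (hs ⟨le_cubeTop _ _, le_rfl⟩).2.trans h.2⟩

theorem inBox_iff {lo hi x : V → ℤ} {I : Finset V} :
    InBox lo hi x I ↔ ∀ u, lo u ≤ x u ∧ x u + (if u ∈ I then 1 else 0) ≤ hi u := by
  simp only [InBox, Pi.le_def, cubeTop_apply, forall_and]

/-- The box from `lo` to `hi` is obtained from the point `p` by adding one layer of lattice points at
a time, on either side in some direction, such that the weight does not increase under the
projection of the new layer to the old box. -/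
inductive Collapses (w : (V → ℤ) → ℤ) (p : V → ℤ) : (V → ℤ) → (V → ℤ) → Prop
  | point : Collapses w p p p
  | up {lo hi : V → ℤ} (v : V) (h : Collapses w p lo hi)
      (hw : ∀ l ∈ Set.Icc lo hi, l v = hi v → w l ≤ w (l + Pi.single v 1)) :
      Collapses w p lo (hi + Pi.single v 1)
  | down {lo hi : V → ℤ} (v : V) (h : Collapses w p lo hi)
      (hw : ∀ l ∈ Set.Icc lo hi, l v = lo v → w l ≤ w (l - Pi.single v 1)) :
      Collapses w p (lo - Pi.single v 1) hi

theorem Collapses.le {w : (V → ℤ) → ℤ} {p lo hi : V → ℤ} (h : Collapses w p lo hi) :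
    lo ≤ hi := by
  induction h with
  | point => exact le_rfl
  | up v _ _ ih => exact ih.trans (le_add_of_nonneg_right (Pi.single_nonneg.2 zero_le_one))
  | down v _ _ ih =>
    exact (sub_le_self _ (Pi.single_nonneg.2 zero_le_one)).trans ih

theorem Collapses.weight_le {w : (V → ℤ) → ℤ} {p lo hi : V → ℤ} (h : Collapses w p lo hi) :
    ∀ l ∈ Set.Icc lo hi, w p ≤ w l := by
  induction h with
  | point => rintro l ⟨h1, h2⟩; rw [le_antisymm h1 h2]
  | @up lo hi v h hw ih =>
    rintro l ⟨h1, h2⟩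
    by_cases hl : l ≤ hi
    · exact ih l ⟨h1, hl⟩
    have hc := h.le v
    have hlv : l v = hi v + 1 := by
      by_contra hne
      refine hl fun u => ?_
      have := h2 u
      simp only [Pi.add_apply, Pi.single_apply] at this
      grind
    have hm : l - Pi.single v 1 ∈ Set.Icc lo hi := by
      refine ⟨fun u => ?_, fun u => ?_⟩
      · have := h1 u
        simp only [Pi.sub_apply, Pi.single_apply]
        grind
      · have := h2 u
        simp only [Pi.sub_apply, Pi.add_apply, Pi.single_apply] at this ⊢
        grind
    have := hw _ hm (by simp [hlv])
    rw [sub_add_cancel] at this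
    exact (ih _ hm).trans this
  | @down lo hi v h hw ih =>
    rintro l ⟨h1, h2⟩
    by_cases hl : lo ≤ l
    · exact ih l ⟨hl, h2⟩
    have hc := h.le v
    have hlv : l v = lo v - 1 := by
      by_contra hne
      refine hl fun u => ?_
      have := h1 u
      simp only [Pi.sub_apply, Pi.single_apply] at this
      grind
    have hm : l + Pi.single v 1 ∈ Set.Icc lo hi := by
      refine ⟨fun u => ?_, fun u => ?_⟩
      · have := h1 u
        simp only [Pi.sub_apply, Pi.add_apply, Pi.single_apply] at this ⊢
        grind
      · have := h2 u
        simp only [Pi.add_apply, Pi.single_apply]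
        grind
    have := hw _ hm (by simp [hlv])
    rw [add_sub_cancel_right] at this
    exact (ih _ hm).trans this

/-- Every cocycle of level at most `N` on the box is the sum of a coboundary and an augmentation,
both of level at most `N`. -/
def BoxAcyclic (w : (V → ℤ) → ℤ) (M : Type*) [AddCommGroup M] [Module ℤ[X] M] (m N : ℤ)
    (lo hi : V → ℤ) : Prop :=
  ∀ Φ : (V → ℤ) → Finset V → M, LevelLE w N Φ →
    (∀ x I, InBox lo hi x I → delta w Φ x I = 0) →
    ∃ (Ψ : (V → ℤ) → Finset V → M) (t : M), LevelLE w N Ψ ∧ LevelLE w N (augment w m t) ∧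
      ∀ x I, InBox lo hi x I → Φ x I = delta w Ψ x I + augment w m t x I

theorem boxAcyclic_point {w : (V → ℤ) → ℤ} {p : V → ℤ} (hp : ∀ x, w p ≤ w x) (N : ℤ) :
    BoxAcyclic w M (w p) N p p := by
  intro Φ hΦ _
  refine ⟨fun _ _ => 0, Φ p ∅, fun x I => smul_zero _, levelLE_augment hp ?_, ?_⟩
  · have := hΦ p ∅
    rwa [cubeWeight_empty] at this
  · intro x I hx
    rw [inBox_iff] at hx
    have hI : I = ∅ := by
      refine Finset.eq_empty_of_forall_notMem fun u hu => ?_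
      have := hx u
      rw [if_pos hu] at this
      omega
    have hxp : x = p := by
      ext u
      have := hx u
      split_ifs at this <;> omega
    subst hI hxp
    simp [augment]

/-- Adding a layer to a box.  The new lattice points have `v`-coordinate `c`, and the weight does not
increase under the projection of the layer to the old box; thus a cube in the layer (side `b`) has
the weight of the cube it spans with its projection.  These pairs of cubes are collapsed
together. -/
theorem BoxAcyclic.add_layer {w : (V → ℤ) → ℤ} {m N : ℤ} {lo hi lo' hi' : V → ℤ} (v : V)
    (b : Bool) (c : ℤ) (hm : ∀ x, m ≤ w x)
    (hold : ∀ x I, InBox lo hi x I → InBox lo' hi' x I ∧ (v ∉ I → x v ≠ c))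
    (hnew : ∀ x I, InBox lo' hi' x I → InBox lo hi x I ∨
      (v ∈ I ∧ (x + faceShift b v) v = c) ∨ (v ∉ I ∧ x v = c))
    (hpair : ∀ x I, InBox lo' hi' x I → v ∉ I → x v = c →
      InBox lo' hi' (x - faceShift b v) (insert v I) ∧
        cubeWeight w (x - faceShift b v) (insert v I) = cubeWeight w x I)
    (h : BoxAcyclic w M m N lo hi) : BoxAcyclic w M m N lo' hi' := by
  intro Φ hΦ hcoc
  obtain ⟨Ψ₀, t, hΨ₀, ht, heq⟩ := h Φ hΦ fun x I hx => hcoc x I (hold x I hx).1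
  -- subtracting the solution on the old box leaves a cocycle `Φ₁` vanishing there
  set Φ₁ : (V → ℤ) → Finset V → M := fun x I => Φ x I - (delta w Ψ₀ x I + augment w m t x I)
    with hΦ₁
  have hl₁ : LevelLE w N Φ₁ := hΦ.sub (hΨ₀.delta.add ht)
  have hcoc₁ : ∀ x I, InBox lo' hi' x I → delta w Φ₁ x I = 0 := by
    intro x I hx
    rw [hΦ₁, delta_sub, delta_add, hcoc x I hx, delta_delta, delta_augment hm, add_zero, sub_zero]
  have hz₁ : ∀ x I, InBox lo hi x I → Φ₁ x I = 0 := fun x I hx => sub_eq_zero.2 (heq x I hx)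
  classical
  -- `Ψ₁` carries the values of `Φ₁` from the cubes spanned with the projection to the layer
  set Ψ₁ : (V → ℤ) → Finset V → M := fun x I =>
    if InBox lo' hi' x I ∧ v ∉ I ∧ x v = c then
      incidence (insert v I) v b • Φ₁ (x - faceShift b v) (insert v I) else 0 with hΨ₁
  have hlΨ : LevelLE w N Ψ₁ := by
    intro x I
    simp only [hΨ₁]
    split_ifs with hx
    · have := hl₁ (x - faceShift b v) (insert v I)
      rw [(hpair x I hx.1 hx.2.1 hx.2.2).2] at this
      rw [smul_comm, this, smul_zero]
    · exact smul_zero _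
  have hne : ∀ x : V → ℤ, ∀ d : Bool, (x + faceShift b v) v = c → d ≠ b →
      (x + faceShift d v) v ≠ c := by
    intro x d h1 h2 h3
    simp only [Pi.add_apply, faceShift_apply, if_true] at h1 h3
    cases b <;> cases d <;> simp_all
  have hwt : ∀ x I, InBox lo' hi' x I → v ∈ I → (x + faceShift b v) v = c →
      cubeWeight w (x + faceShift b v) (I.erase v) = cubeWeight w x I := by
    intro x I hx hv hc
    have := (hpair _ _ (hx.face hv b) (Finset.notMem_erase v I) hc).2
    rwa [add_sub_cancel_right, Finset.insert_erase hv, eq_comm] at this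
  have hold₂ : ∀ x I, InBox lo hi x I → delta w Ψ₁ x I = 0 := by
    intro x I hx
    refine Finset.sum_eq_zero fun u hu => Finset.sum_eq_zero fun d _ => ?_
    have h0 : Ψ₁ (x + faceShift d u) (I.erase u) = 0 :=
      if_neg fun h => (hold _ _ (hx.face hu d)).2 h.2.1 h.2.2
    rw [h0, smul_zero, smul_zero]
  have hmid : ∀ x I, InBox lo' hi' x I → v ∈ I → (x + faceShift b v) v = c →
      delta w Ψ₁ x I = Φ₁ x I := by
    intro x I hx hv hc
    rw [delta_eq_of_forall_facet_eq_zero hv b (hwt x I hx hv hc)]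
    · simp only [hΨ₁]
      rw [if_pos ⟨hx.face hv b, Finset.notMem_erase v I, hc⟩, Finset.insert_erase hv,
        add_sub_cancel_right, smul_smul, incidence_mul_self, one_smul]
    · intro u hu d hud
      refine if_neg fun h => ?_
      have huv : u = v := by
        by_contra huv
        exact h.2.1 (Finset.mem_erase.2 ⟨Ne.symm huv, hv⟩)
      subst huv
      exact hne x d hc (fun hd => hud (by rw [hd])) h.2.2
  have hz₂ : ∀ x I, InBox lo' hi' x I → v ∈ I → Φ₁ x I - delta w Ψ₁ x I = 0 := by
    intro x I hx hv
    rcases hnew x I hx with h | h | h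
    · rw [hz₁ x I h, hold₂ x I h, sub_zero]
    · rw [hmid x I hx hv h.2, sub_self]
    · exact absurd hv h.1
  have hz₃ : ∀ x I, InBox lo hi x I → Φ₁ x I - delta w Ψ₁ x I = 0 := by
    intro x I hx
    rw [hz₁ x I hx, hold₂ x I hx, sub_zero]
  have hall : ∀ x I, InBox lo' hi' x I → Φ₁ x I = delta w Ψ₁ x I := by
    intro x I hx
    rw [← sub_eq_zero]
    by_cases hv : v ∈ I
    · exact hz₂ x I hx hv
    rcases hnew x I hx with h | h | ⟨-, hc⟩
    · exact hz₃ x I h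
    · exact absurd h.1 hv
    -- on a cube of the layer, use the cocycle condition on the cube it spans with its projection
    obtain ⟨hx', hw'⟩ := hpair x I hx hv hc
    have hvI : v ∈ insert v I := Finset.mem_insert_self v I
    have e1 : x - faceShift b v + faceShift b v = x := sub_add_cancel _ _
    have e2 : (insert v I).erase v = I := Finset.erase_insert hv
    have hz : delta w (fun y J => Φ₁ y J - delta w Ψ₁ y J) (x - faceShift b v) (insert v I) = 0 := by
      rw [delta_sub, hcoc₁ _ _ hx', delta_delta, sub_zero]
    rw [delta_eq_of_forall_facet_eq_zero hvI b (by rw [e1, e2, hw'])] at hz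
    · rw [e1, e2] at hz
      rw [← one_smul ℤ[X] (Φ₁ x I - delta w Ψ₁ x I), ← incidence_mul_self (insert v I) v b,
        mul_smul, hz, smul_zero]
    · intro u hu d hud
      by_cases huv : u = v
      · subst huv
        have hd : d ≠ b := fun hd => hud (by rw [hd])
        have hf := hx'.face hvI d
        rcases hnew _ _ hf with h | h | h
        · exact hz₃ _ _ h
        · exact absurd h.1 (Finset.notMem_erase u _)
        · exact absurd h.2 (hne _ d (by rw [e1, hc]) hd)
      · exact hz₂ _ _ (hx'.face hu d) (Finset.mem_erase.2 ⟨Ne.symm huv, hvI⟩)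
  refine ⟨fun x I => Ψ₀ x I + Ψ₁ x I, t, hΨ₀.add hlΨ, ht, fun x I hx => ?_⟩
  rw [delta_add, ← hall x I hx]
  simp only [hΦ₁]
  abel

theorem Collapses.boxAcyclic {w : (V → ℤ) → ℤ} {p lo hi : V → ℤ} (hp : ∀ x, w p ≤ w x) (N : ℤ)
    (h : Collapses w p lo hi) : BoxAcyclic w M (w p) N lo hi := by
  induction h with
  | point => exact boxAcyclic_point hp N
  | @up lo hi v h hw ih =>
    have hc := h.le v
    refine ih.add_layer v true (hi v + 1) hp ?_ ?_ ?_
    · intro x I hx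
      rw [inBox_iff] at hx ⊢
      refine ⟨fun u => ?_, fun hv hxv => ?_⟩
      · have := hx u
        simp only [Pi.add_apply, Pi.single_apply]
        grind
      · have := hx v
        grind
    · intro x I hx
      by_cases hv : v ∈ I <;> by_cases hxv : x v + (if v ∈ I then 1 else 0) = hi v + 1
      · right; left
        exact ⟨hv, by simpa [faceShift_apply, hv] using hxv⟩
      · left
        rw [inBox_iff] at hx ⊢
        intro u
        have := hx u
        simp only [Pi.add_apply, Pi.single_apply] at this
        grind
      · right; right
        exact ⟨hv, by simpa [hv] using hxv⟩
      · left
        rw [inBox_iff] at hx ⊢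
        intro u
        have := hx u
        simp only [Pi.add_apply, Pi.single_apply] at this
        grind
    · intro x I hx hv hxv
      rw [inBox_iff] at hx
      refine ⟨?_, le_antisymm (cubeWeight_le_iff.2 ?_) ?_⟩
      · rw [inBox_iff]
        intro u
        have := hx u
        simp only [Pi.add_apply, Pi.sub_apply, Pi.single_apply, faceShift_apply,
          Finset.mem_insert] at this ⊢
        grind
      · rintro l ⟨h1, h2⟩
        by_cases hlv : l v = x v
        · refine le_cubeWeight w ⟨fun u => ?_, fun u => ?_⟩
          · have := h1 u
            simp only [Pi.sub_apply, faceShift_apply] at this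
            grind
          · have := h2 u
            simp only [cubeTop_apply, Pi.sub_apply, faceShift_apply, Finset.mem_insert] at this ⊢
            grind
        · have hlv' : l v = hi v := by
            have h1 := h1 v
            have h2 := h2 v
            simp only [cubeTop_apply, Pi.sub_apply, faceShift_apply, Finset.mem_insert] at h1 h2
            grind
          refine (hw l ⟨fun u => ?_, fun u => ?_⟩ hlv').trans
            (le_cubeWeight w ⟨fun u => ?_, fun u => ?_⟩)
          · have h1 := h1 u
            have := hx u
            simp only [Pi.sub_apply, faceShift_apply] at h1
            grind
          · have h2 := h2 u
            have := hx u
            simp only [cubeTop_apply, Pi.sub_apply, Pi.add_apply, Pi.single_apply, faceShift_apply,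
              Finset.mem_insert] at h2 this
            grind
          · have h1 := h1 u
            simp only [Pi.sub_apply, Pi.add_apply, Pi.single_apply, faceShift_apply] at h1 ⊢
            grind
          · have h2 := h2 u
            simp only [cubeTop_apply, Pi.sub_apply, Pi.add_apply, Pi.single_apply, faceShift_apply,
              Finset.mem_insert] at h2 ⊢
            grind
      · have := cubeWeight_face_le w (x - faceShift true v) (Finset.mem_insert_self v I) true
        rwa [sub_add_cancel, Finset.erase_insert hv] at this
  | @down lo hi v h hw ih =>
    have hc := h.le v
    refine ih.add_layer v false (lo v - 1) hp ?_ ?_ ?_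
    · intro x I hx
      rw [inBox_iff] at hx ⊢
      refine ⟨fun u => ?_, fun hv hxv => ?_⟩
      · have := hx u
        simp only [Pi.sub_apply, Pi.single_apply]
        grind
      · have := hx v
        grind
    · intro x I hx
      by_cases hxv : x v = lo v - 1
      · right
        by_cases hv : v ∈ I
        · left
          exact ⟨hv, by simpa [faceShift_apply] using hxv⟩
        · exact Or.inr ⟨hv, hxv⟩
      · left
        rw [inBox_iff] at hx ⊢
        intro u
        have := hx u
        simp only [Pi.sub_apply, Pi.single_apply] at this
        grind
    · intro x I hx hv hxv
      have e0 : x - faceShift false v = x := by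
        ext u; simp [faceShift_apply]
      rw [e0]
      rw [inBox_iff] at hx
      refine ⟨?_, le_antisymm (cubeWeight_le_iff.2 ?_) ?_⟩
      · rw [inBox_iff]
        intro u
        have := hx u
        simp only [Pi.sub_apply, Pi.single_apply, Finset.mem_insert] at this ⊢
        grind
      · rintro l ⟨h1, h2⟩
        by_cases hlv : l v = x v
        · refine le_cubeWeight w ⟨h1, fun u => ?_⟩
          have := h2 u
          simp only [cubeTop_apply, Finset.mem_insert] at this ⊢
          grind
        · have hlv' : l v = lo v := by
            have h1 := h1 v
            have h2 := h2 v
            simp only [cubeTop_apply, Finset.mem_insert] at h1 h2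
            grind
          refine (hw l ⟨fun u => ?_, fun u => ?_⟩ hlv').trans
            (le_cubeWeight w ⟨fun u => ?_, fun u => ?_⟩)
          · have h1 := h1 u
            have := hx u
            simp only [Pi.sub_apply, Pi.single_apply] at this
            grind
          · have h2 := h2 u
            have := hx u
            simp only [cubeTop_apply, Finset.mem_insert] at h2 this
            grind
          · have h1 := h1 u
            simp only [Pi.sub_apply, Pi.single_apply]
            grind
          · have h2 := h2 u
            simp only [cubeTop_apply, Pi.sub_apply, Pi.single_apply, Finset.mem_insert] at h2 ⊢
            grind
      · have := cubeWeight_face_le w x (Finset.mem_insert_self v I) false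
        have e1 : x + faceShift false v = x := by
          ext u; simp [faceShift_apply]
        rwa [e1, Finset.erase_insert hv] at this

end Cubes

end LatticeCohomology

/-! ### The module `𝒯⁺` -/

/-- The element `U⁻ᵈ` of `𝒯⁺`. -/
noncomputable def towerMonomial (d : ℕ) : TPlus :=
  Module.AEval'.of towerU (Finsupp.single d 1)

theorem towerU_pow_apply (n : ℕ) (f : ℕ →₀ ℤ) (d : ℕ) : (towerU ^ n) f d = f (d + n) := by
  induction n generalizing f with
  | zero => simp
  | succ n ih =>
    rw [pow_succ, Module.End.mul_apply, ih]
    simp only [towerU, Finsupp.lcomapDomain, LinearMap.coe_mk, AddHom.coe_mk,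
      Finsupp.comapDomain_apply]
    rfl

theorem TPlus.X_pow_smul_of (n : ℕ) (f : ℕ →₀ ℤ) :
    (Polynomial.X : ℤ[X]) ^ n • Module.AEval'.of towerU f =
      Module.AEval'.of towerU ((towerU ^ n) f) :=
  Module.AEval'.X_pow_smul_of towerU f n

theorem X_pow_smul_towerMonomial {n d : ℕ} (h : n ≤ d) :
    (Polynomial.X : ℤ[X]) ^ n • towerMonomial d = towerMonomial (d - n) := by
  rw [towerMonomial, TPlus.X_pow_smul_of, towerMonomial]
  congr 1
  ext e
  rw [towerU_pow_apply, Finsupp.single_apply, Finsupp.single_apply]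
  congr 1
  exact propext ⟨fun h => by omega, fun h => by omega⟩

theorem X_pow_smul_towerMonomial_of_lt {n d : ℕ} (h : d < n) :
    (Polynomial.X : ℤ[X]) ^ n • towerMonomial d = 0 := by
  rw [towerMonomial, TPlus.X_pow_smul_of, ← map_zero (Module.AEval'.of towerU)]
  congr 1
  ext e
  rw [towerU_pow_apply, Finsupp.single_apply, if_neg (by omega), Finsupp.zero_apply]

theorem towerMonomial_ne_zero (d : ℕ) : towerMonomial d ≠ 0 := by
  rw [towerMonomial, Ne, LinearEquiv.map_eq_zero_iff, Finsupp.single_eq_zero]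
  exact one_ne_zero

theorem TPlus.exists_X_pow_smul_eq_zero (t : TPlus) :
    ∃ n : ℕ, (Polynomial.X : ℤ[X]) ^ n • t = 0 := by
  obtain ⟨f, rfl⟩ := (Module.AEval'.of towerU).surjective t
  refine ⟨f.support.sup id + 1, ?_⟩
  rw [TPlus.X_pow_smul_of, ← map_zero (Module.AEval'.of towerU)]
  congr 1
  ext e
  rw [towerU_pow_apply, Finsupp.zero_apply]
  by_contra hne
  have := Finset.le_sup (f := id) (Finsupp.mem_support_iff.2 hne)
  simp only [id] at this
  omega

/-! ### From boxes to lattice cohomology -/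

namespace LatticeCohomology

section Bridge

variable {V : Type*}

theorem weight_eq_cubeWeight [LinearOrder V] (w : (V → ℤ) → ℤ) {q : ℕ} (c : LatticeCube V q) :
    c.weight w = cubeWeight w c.base c.dirs := rfl

/-- The extension of a cochain by zero to the cubes of all other dimensions. -/
noncomputable def Cochain.extend {q : ℕ} (φ : Cochain V q) (x : V → ℤ) (I : Finset V) : TPlus :=
  if h : I.card = q then φ ⟨x, I, h⟩ else 0

theorem Cochain.extend_apply {q : ℕ} (φ : Cochain V q) (c : LatticeCube V q) :
    φ.extend c.base c.dirs = φ c := by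
  rw [Cochain.extend, dif_pos c.card_dirs]

theorem delta_extend_of_card_ne [LinearOrder V] (w : (V → ℤ) → ℤ) {q : ℕ} (φ : Cochain V q) (x : V → ℤ)
    {I : Finset V} (hI : I.card ≠ q + 1) : delta w φ.extend x I = 0 := by
  refine Finset.sum_eq_zero fun v hv => Finset.sum_eq_zero fun b _ => ?_
  have := Finset.card_erase_add_one hv
  rw [Cochain.extend, dif_neg (by omega), smul_zero, smul_zero]

theorem Cochain.exists_levelLE_extend [LinearOrder V] (w : (V → ℤ) → ℤ) {q : ℕ} (φ : Cochain V q) :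
    ∃ N, LevelLE w N φ.extend := by
  choose n hn using TPlus.exists_X_pow_smul_eq_zero
  obtain ⟨N, hN⟩ := (φ.support.image fun c => c.weight w + n (φ c)).exists_le
  refine ⟨N, fun x I => ?_⟩
  rw [Cochain.extend]
  split_ifs with h
  · by_cases hc : φ ⟨x, I, h⟩ = 0
    · rw [hc, smul_zero]
    · have := hN _ (Finset.mem_image_of_mem _ (Finsupp.mem_support_iff.2 hc))
      rw [weight_eq_cubeWeight] at this
      exact X_pow_smul_eq_zero_of_le (by simp only at this; omega) (hn _)
  · exact smul_zero _

variable [Fintype V] [LinearOrder V]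

theorem coboundary_apply (w : (V → ℤ) → ℤ) {q : ℕ} (φ : Cochain V q) (c : LatticeCube V (q + 1)) :
    coboundary w q φ c = delta w φ.extend c.base c.dirs := by
  change coboundaryFun w φ c = _
  rw [delta, ← Finset.sum_coe_sort, coboundaryFun]
  refine Finset.sum_congr rfl fun v _ => ?_
  have h1 : c.base + faceShift true v.1 = (c.upperFace v v.2).base := by
    simp [faceShift, LatticeCube.upperFace]
  have h0 : c.base + faceShift false v.1 = (c.lowerFace v v.2).base := by
    simp [faceShift, LatticeCube.lowerFace]
  rw [Fintype.sum_bool, h1, h0]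
  change _ = incidence c.dirs v.1 true • (Polynomial.X : ℤ[X]) ^
      (c.weight w - (c.upperFace v v.2).weight w).toNat •
        φ.extend (c.upperFace v v.2).base (c.upperFace v v.2).dirs +
    incidence c.dirs v.1 false • (Polynomial.X : ℤ[X]) ^
      (c.weight w - (c.lowerFace v v.2).weight w).toNat •
        φ.extend (c.lowerFace v v.2).base (c.lowerFace v v.2).dirs
  rw [Cochain.extend_apply, Cochain.extend_apply, smul_sub]
  simp [incidence, LatticeCube.sign, sub_eq_add_neg]

/-- A function of bounded level has finite support if the sublevel sets of `w` are finite. -/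
theorem LevelLE.finite_support {w : (V → ℤ) → ℤ} {N : ℤ} (hfin : {x | w x ≤ N}.Finite)
    {Ψ : (V → ℤ) → Finset V → TPlus} (hΨ : LevelLE w N Ψ) (q : ℕ) :
    (Function.support fun c : LatticeCube V q => Ψ c.base c.dirs).Finite := by
  have hinj : Function.Injective fun c : LatticeCube V q => (c.base, c.dirs) := by
    intro c d h
    simp only [Prod.mk.injEq] at h
    exact LatticeCube.ext h.1 h.2
  refine ((hfin.prod (Set.finite_univ (α := Finset V))).preimage hinj.injOn).subset ?_
  intro c hc
  refine ⟨?_, Set.mem_univ _⟩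
  by_contra hlt
  have h1 := le_cubeWeight w (x := c.base) (I := c.dirs) ⟨le_rfl, le_cubeTop _ _⟩
  simp only [Set.mem_ofPred_eq, not_le] at hlt
  exact hc (hΨ.eq_zero (hlt.trans_le h1))

/-- If all boxes around `p` collapse to `p`, then the reduced lattice cohomology vanishes. -/
theorem subsingleton_reduced_of_collapses {w : (V → ℤ) → ℤ} {p : V → ℤ}
    (hfin : ∀ N, {x | w x ≤ N}.Finite)
    (hcol : ∀ lo hi, lo ≤ p → p ≤ hi → Collapses w p lo hi) (q : ℕ) :
    Subsingleton (Reduced w q) := by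
  have hp : ∀ x, w p ≤ w x := fun x =>
    (hcol (p ⊓ x) (p ⊔ x) inf_le_left le_sup_left).weight_le x ⟨inf_le_right, le_sup_right⟩
  have hinf : ⨅ l, w l = w p :=
    le_antisymm (ciInf_le ⟨w p, by rintro _ ⟨x, rfl⟩; exact hp x⟩ p) (le_ciInf hp)
  rw [Submodule.Quotient.subsingleton_iff, eq_top_iff]
  rintro ⟨φ, hφ⟩ -
  change φ ∈ augmentedCoboundaries w q
  obtain ⟨N, hN⟩ := φ.exists_levelLE_extend w
  have hcoc : ∀ x I, delta w φ.extend x I = 0 := by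
    intro x I
    by_cases hI : I.card = q + 1
    · have := coboundary_apply w φ ⟨x, I, hI⟩
      rw [LinearMap.mem_ker.1 hφ] at this
      exact this.symm
    · exact delta_extend_of_card_ne w φ x hI
  obtain ⟨a, ha⟩ := (hfin N).bddAbove
  obtain ⟨b, hb⟩ := (hfin N).bddBelow
  obtain ⟨Ψ, t, hΨ, ht, heq⟩ := (hcol (p ⊓ b) (p ⊔ a) inf_le_left le_sup_left).boxAcyclic hp N
    φ.extend hN fun x I _ => hcoc x I
  -- a cube outside the box has weight above `N`, so that cochains of level `N` vanish on it
  have hall : ∀ x I, φ.extend x I = delta w Ψ x I + augment w (w p) t x I := by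
    intro x I
    by_cases hx : cubeWeight w x I ≤ N
    · refine heq x I ⟨inf_le_right.trans (hb ?_), le_sup_of_le_right (ha ?_)⟩
      · exact (le_cubeWeight w ⟨le_rfl, le_cubeTop x I⟩).trans hx
      · exact (le_cubeWeight w ⟨le_cubeTop x I, le_rfl⟩).trans hx
    · rw [hN.eq_zero (not_le.1 hx), hΨ.delta.eq_zero (not_le.1 hx), ht.eq_zero (not_le.1 hx),
        add_zero]
  cases q with
  | zero =>
    refine ⟨t, fun c => ?_⟩
    have hc : c.dirs = ∅ := Finset.card_eq_zero.1 c.card_dirs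
    rw [← Cochain.extend_apply, hall, hc, delta_empty, zero_add, augment, if_pos rfl, hinf]
  | succ q =>
    refine ⟨Finsupp.ofSupportFinite (fun c => Ψ c.base c.dirs) (hΨ.finite_support (hfin N) q), ?_⟩
    ext1 c
    have hc : c.dirs ≠ ∅ := by
      intro h
      have := c.card_dirs
      rw [h, Finset.card_empty] at this
      omega
    rw [coboundary_apply, ← Cochain.extend_apply φ, hall, augment, if_neg hc, add_zero]
    refine Finset.sum_congr rfl fun v hv => Finset.sum_congr rfl fun b _ => ?_
    have hcard : (c.dirs.erase v).card = q := by
      rw [Finset.card_erase_of_mem hv, c.card_dirs, Nat.add_sub_cancel]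
    rw [Cochain.extend, dif_pos hcard]
    rfl

/-- If the sublevel set of `w` at height `n` is disconnected, namely contains a point `a` of a set
`A` and a point `b` outside `A` but no edge joining `A` to its complement, then
`ℍ⁰_red ≠ 0`. -/
theorem not_subsingleton_reduced_zero {w : (V → ℤ) → ℤ} {n : ℤ} (hfin : {x | w x ≤ n}.Finite)
    (hbdd : BddBelow (Set.range w)) (A : Set (V → ℤ)) {a b : V → ℤ} (ha : a ∈ A) (hb : b ∉ A)
    (hwa : w a ≤ n) (hwb : w b ≤ n)
    (hA : ∀ l v, w l ≤ n → w (l + Pi.single v 1) ≤ n → (l ∈ A ↔ l + Pi.single v 1 ∈ A)) :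
    ¬ Subsingleton (Reduced w 0) := by
  classical
  -- the indicator function of the part of the sublevel set in `A`, as a cochain of level `n`
  set f : LatticeCube V 0 → TPlus := fun c =>
    if c.base ∈ A ∧ w c.base ≤ n then towerMonomial (n - w c.base).toNat else 0 with hf
  have hsupp : (Function.support f).Finite := by
    have hinj : Function.Injective fun c : LatticeCube V 0 => c.base := by
      intro c d h
      refine LatticeCube.ext h ?_
      rw [Finset.card_eq_zero.1 c.card_dirs, Finset.card_eq_zero.1 d.card_dirs]
    refine (hfin.preimage hinj.injOn).subset fun c hc => ?_
    by_contra hlt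
    exact hc (if_neg fun h => hlt h.2)
  set φ : Cochain V 0 := Finsupp.ofSupportFinite f hsupp with hφ
  have hφf : ∀ c, φ c = f c := fun c => rfl
  have hval : ∀ (c : LatticeCube V 0) (W : ℤ), w c.base ≤ W →
      (Polynomial.X : ℤ[X]) ^ (W - w c.base).toNat • φ c =
        if c.base ∈ A ∧ W ≤ n then towerMonomial (n - W).toNat else 0 := by
    intro c W hW
    rw [hφf, hf]
    by_cases hc : c.base ∈ A
    · by_cases hn : W ≤ n
      · simp only [hc, hn, hW.trans hn, true_and, if_true]
        rw [X_pow_smul_towerMonomial (by omega)]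
        congr 1
        omega
      · simp only [hc, hn, true_and, if_false]
        split_ifs with h
        · exact X_pow_smul_towerMonomial_of_lt (by omega)
        · exact smul_zero _
    · simp [hc]
  have hw0 : ∀ c : LatticeCube V 0, c.weight w = w c.base := by
    intro c
    rw [weight_eq_cubeWeight, Finset.card_eq_zero.1 c.card_dirs, cubeWeight_empty]
  have hker : φ ∈ LinearMap.ker (coboundary w 0) := by
    rw [LinearMap.mem_ker]
    ext1 c
    change coboundaryFun w φ c = 0
    refine Finset.sum_eq_zero fun v _ => ?_
    have h1 : w (c.upperFace v v.2).base ≤ c.weight w := by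
      refine le_cubeWeight w ⟨?_, ?_⟩
      · exact le_add_of_nonneg_right (Pi.single_nonneg.2 zero_le_one)
      · intro u
        have := v.2
        simp only [LatticeCube.upperFace, Pi.add_apply, Pi.single_apply, cubeTop_apply]
        grind
    have h0 : w (c.lowerFace v v.2).base ≤ c.weight w :=
      le_cubeWeight w ⟨le_rfl, le_cubeTop _ _⟩
    rw [hw0, hw0, hval _ _ h1, hval _ _ h0]
    have : ((c.upperFace v v.2).base ∈ A ∧ c.weight w ≤ n) ↔
        ((c.lowerFace v v.2).base ∈ A ∧ c.weight w ≤ n) :=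
      and_congr_left fun hn => (hA _ v (h0.trans hn) (h1.trans hn)).symm
    simp only [this, sub_self, smul_zero]
  rw [Submodule.Quotient.subsingleton_iff]
  intro htop
  have hmem : (⟨φ, hker⟩ : LinearMap.ker (coboundary w 0)) ∈
      (augmentedCoboundaries w 0).submoduleOf (LinearMap.ker (coboundary w 0)) := by
    rw [htop]; trivial
  obtain ⟨t, ht⟩ : φ ∈ augmentationImage w := hmem
  have key : ∀ c : LatticeCube V 0, w c.base ≤ n →
      (if c.base ∈ A then towerMonomial 0 else 0) =
        (Polynomial.X : ℤ[X]) ^ (n - ⨅ l, w l).toNat • t := by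
    intro c hc
    have h := hval c n hc
    rw [ht c, smul_smul, ← pow_add] at h
    simp only [le_refl, and_true, sub_self, Int.toNat_zero] at h
    rw [← h]
    congr 2
    have : ⨅ l, w l ≤ w c.base := ciInf_le hbdd c.base
    omega
  have h1 := key ⟨a, ∅, rfl⟩ hwa
  have h2 := key ⟨b, ∅, rfl⟩ hwb
  simp only [ha, hb, if_true, if_false] at h1 h2
  exact towerMonomial_ne_zero 0 (h1.trans h2.symm)

end Bridge

end LatticeCohomology

/-! ### The intersection form -/

namespace PlumbingTree

section Form

variable {V : Type*} (Γ : PlumbingTree V)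

theorem intersectionMatrix_self (v : V) : Γ.intersectionMatrix v v = Γ.weight v := by
  simp [intersectionMatrix]

theorem intersectionMatrix_of_ne {u v : V} (h : u ≠ v) [Decidable (Γ.graph.Adj u v)] :
    Γ.intersectionMatrix u v = if Γ.graph.Adj u v then 1 else 0 := by
  simp only [intersectionMatrix, Matrix.of_apply, if_neg h]
  congr

theorem intersectionMatrix_nonneg {u v : V} (h : u ≠ v) : 0 ≤ Γ.intersectionMatrix u v := by
  classical
  rw [Γ.intersectionMatrix_of_ne h]
  split_ifs <;> simp

theorem intersectionMatrix_of_adj {u v : V} (h : Γ.graph.Adj u v) :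
    Γ.intersectionMatrix u v = 1 := by
  classical
  rw [Γ.intersectionMatrix_of_ne h.ne, if_pos h]

theorem intersectionMatrix_comm (u v : V) :
    Γ.intersectionMatrix u v = Γ.intersectionMatrix v u := by
  rcases eq_or_ne u v with rfl | h
  · rfl
  · classical
    rw [Γ.intersectionMatrix_of_ne h, Γ.intersectionMatrix_of_ne h.symm]
    simp only [Γ.graph.adj_comm u v]

variable [Fintype V]

theorem form_add_left (x y z : V → ℤ) : Γ.form (x + y) z = Γ.form x z + Γ.form y z := by
  simp [form, add_dotProduct]

theorem form_add_right (x y z : V → ℤ) : Γ.form x (y + z) = Γ.form x y + Γ.form x z := by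
  simp [form, Matrix.mulVec_add, dotProduct_add]

theorem form_sub_left (x y z : V → ℤ) : Γ.form (x - y) z = Γ.form x z - Γ.form y z := by
  simp [form, sub_dotProduct]

@[simp]
theorem form_neg_left (x y : V → ℤ) : Γ.form (-x) y = -Γ.form x y := by
  simp [form]

@[simp]
theorem form_neg_right (x y : V → ℤ) : Γ.form x (-y) = -Γ.form x y := by
  simp [form, Matrix.mulVec_neg]

@[simp]
theorem form_zero_left (x : V → ℤ) : Γ.form 0 x = 0 := by
  simp [form]

@[simp]
theorem form_zero_right (x : V → ℤ) : Γ.form x 0 = 0 := by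
  simp [form]

theorem form_comm (x y : V → ℤ) : Γ.form x y = Γ.form y x := by
  have hM : Γ.intersectionMatrix.transpose = Γ.intersectionMatrix := by
    ext u v; exact Γ.intersectionMatrix_comm v u
  rw [form, form, Matrix.dotProduct_mulVec, ← Matrix.mulVec_transpose, hM, dotProduct_comm]

variable {Γ}

theorem cast_form (x : V → ℤ) :
    ((-Γ.form x x : ℤ) : ℝ) = star (fun v => (x v : ℝ)) ⬝ᵥ
      (-(Γ.intersectionMatrix.map (Int.cast : ℤ → ℝ))).mulVec (fun v => (x v : ℝ)) := by
  simp [form, dotProduct, Matrix.mulVec]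

theorem NegativeDefinite.form_self_neg (h : Γ.NegativeDefinite) {x : V → ℤ} (hx : x ≠ 0) :
    Γ.form x x < 0 := by
  have hx' : (fun v => (x v : ℝ)) ≠ 0 := by
    contrapose! hx
    ext v
    have := congrFun hx v
    simpa using this
  have := Matrix.PosDef.dotProduct_mulVec_pos h hx'
  rw [← cast_form, Int.cast_pos] at this
  omega

/-- By compactness of the unit sphere, `-⟨y, y⟩ ≥ ε ‖y‖²` on `ℝ^V`. -/
theorem NegativeDefinite.exists_pos_le (h : Γ.NegativeDefinite) :
    ∃ ε : ℝ, 0 < ε ∧ ∀ x : V → ℤ, ε * ‖fun v => (x v : ℝ)‖ ^ 2 ≤ ((-Γ.form x x : ℤ) : ℝ) := by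
  set A := -(Γ.intersectionMatrix.map (Int.cast : ℤ → ℝ)) with hA
  have : Nonempty V := Γ.isTree.connected.nonempty
  have hcont : Continuous fun y : V → ℝ => y ⬝ᵥ A.mulVec y := by
    simp only [dotProduct, Matrix.mulVec]
    fun_prop
  obtain ⟨y, hy, hmin⟩ := (isCompact_sphere (0 : V → ℝ) 1).exists_isMinOn
    (NormedSpace.sphere_nonempty.2 zero_le_one) hcont.continuousOn
  have hy0 : y ≠ 0 := by
    rintro rfl
    simp at hy
  refine ⟨y ⬝ᵥ A.mulVec y, by simpa using Matrix.PosDef.dotProduct_mulVec_pos h hy0, fun x => ?_⟩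
  rw [cast_form, ← hA, star_trivial]
  set z : V → ℝ := fun v => (x v : ℝ)
  by_cases hz : z = 0
  · simp [hz]
  have hz' : ‖z‖ ≠ 0 := norm_ne_zero_iff.2 hz
  have hs : ‖z‖⁻¹ • z ∈ Metric.sphere (0 : V → ℝ) 1 := by
    simp [norm_smul, hz']
  have : y ⬝ᵥ A.mulVec y ≤ (‖z‖⁻¹ • z) ⬝ᵥ A.mulVec (‖z‖⁻¹ • z) := hmin hs
  simp only [Matrix.mulVec_smul, smul_dotProduct, dotProduct_smul, smul_eq_mul] at this
  rw [← mul_assoc, ← mul_inv, ← div_eq_inv_mul,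
    le_div_iff₀ (mul_self_pos.2 hz')] at this
  rwa [pow_two]

/-! ### Riemann–Roch functions and the canonical functional -/

variable {k : (V → ℤ) →ₗ[ℤ] ℤ}

theorem IsCharacteristic.two_mul_chi (hk : Γ.IsCharacteristic k) (x : V → ℤ) :
    2 * Γ.chi k x = -(k x + Γ.form x x) := by
  have := (hk x).two_dvd
  rw [chi]
  omega

theorem IsCharacteristic.chi_add (hk : Γ.IsCharacteristic k) (x y : V → ℤ) :
    Γ.chi k (x + y) = Γ.chi k x + Γ.chi k y - Γ.form x y := by
  have h1 := hk.two_mul_chi (x + y)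
  have h2 := hk.two_mul_chi x
  have h3 := hk.two_mul_chi y
  rw [form_add_left, form_add_right, form_add_right, Γ.form_comm y x, map_add] at h1
  omega

theorem chi_zero : Γ.chi k 0 = 0 := by
  simp [chi]

variable (Γ) in
/-- The canonical characteristic functional, given by adjunction: `K(E_v) = -w(v) - 2`. -/
def canonical : (V → ℤ) →ₗ[ℤ] ℤ :=
  ∑ v, (-Γ.weight v - 2) • LinearMap.proj v

theorem canonical_apply (x : V → ℤ) : Γ.canonical x = ∑ v, x v * (-Γ.weight v - 2) := by
  simp [canonical, mul_comm]

/-! ### Coordinates of the intersection form -/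

variable [DecidableEq V] (Γ)

theorem form_single_right (x : V → ℤ) (v : V) :
    Γ.form x (Pi.single v 1) = ∑ u, x u * Γ.intersectionMatrix u v := by
  simp [form, dotProduct]

theorem form_single_single (u v : V) :
    Γ.form (Pi.single u 1) (Pi.single v 1) = Γ.intersectionMatrix u v := by
  simp [form_single_right, Pi.single_apply]

theorem form_eq_sum (x y : V → ℤ) : Γ.form x y = ∑ v, y v * Γ.form x (Pi.single v 1) := by
  simp only [form_single_right, Finset.mul_sum]
  rw [Finset.sum_comm]
  simp only [form, dotProduct, Matrix.mulVec, Finset.mul_sum]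
  exact Finset.sum_congr rfl fun u _ => Finset.sum_congr rfl fun v _ => by ring

theorem form_sum_smul_single {ι : Type*} (x : V → ℤ) (s : Finset ι) (m : ι → ℤ) (f : ι → V) :
    Γ.form x (∑ i ∈ s, m i • Pi.single (f i) 1) =
      ∑ i ∈ s, m i * Γ.form x (Pi.single (f i) 1) := by
  classical
  induction s using Finset.induction_on with
  | empty => simp
  | insert i s hi ih =>
    rw [Finset.sum_insert hi, Finset.sum_insert hi, form_add_right, ih]
    congr 1
    rw [form, Matrix.mulVec_smul, dotProduct_smul, smul_eq_mul, form]

/-- The intersection number with `E_v` is increasing in the coefficients off `v`. -/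
theorem form_single_mono {x y : V → ℤ} (hxy : x ≤ y) {v : V} (hv : x v = y v) :
    Γ.form x (Pi.single v 1) ≤ Γ.form y (Pi.single v 1) := by
  simp only [form_single_right]
  refine Finset.sum_le_sum fun u _ => ?_
  by_cases hu : u = v
  · subst hu; rw [hv]
  · exact mul_le_mul_of_nonneg_right (hxy u) (Γ.intersectionMatrix_nonneg hu)

theorem form_single_nonneg {x : V → ℤ} (hx : 0 ≤ x) {v : V} (hv : x v = 0) :
    0 ≤ Γ.form x (Pi.single v 1) := by
  simpa using Γ.form_single_mono hx hv.symm

theorem form_nonneg_of_disjoint {x y : V → ℤ} (hx : 0 ≤ x) (hy : 0 ≤ y)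
    (h : ∀ v, x v = 0 ∨ y v = 0) : 0 ≤ Γ.form x y := by
  rw [form_eq_sum]
  refine Finset.sum_nonneg fun v _ => ?_
  rcases h v with h | h
  · exact mul_nonneg (hy v) (Γ.form_single_nonneg hx h)
  · simp [h]

theorem linear_eq_sum (k : (V → ℤ) →ₗ[ℤ] ℤ) (x : V → ℤ) :
    k x = ∑ v, x v * k (Pi.single v 1) := by
  conv_lhs => rw [pi_eq_sum_univ' x]
  rw [map_sum]
  refine Finset.sum_congr rfl fun v _ => ?_
  rw [map_smul, smul_eq_mul]

/-! ### Consequences of negative definiteness -/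

variable {Γ}

theorem NegativeDefinite.weight_neg (h : Γ.NegativeDefinite) (v : V) : Γ.weight v < 0 := by
  have := h.form_self_neg (x := Pi.single v 1) (by simp)
  rwa [form_single_single, intersectionMatrix_self] at this

theorem NegativeDefinite.exists_form_neg (h : Γ.NegativeDefinite) {b : V → ℤ} (hb : 0 ≤ b)
    (hb' : b ≠ 0) : ∃ v, 0 < b v ∧ Γ.form b (Pi.single v 1) < 0 := by
  by_contra! hcon
  have := h.form_self_neg hb'
  rw [form_eq_sum] at this
  refine absurd this (not_lt.2 (Finset.sum_nonneg fun v _ => ?_))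
  rcases (hb v).lt_or_eq with hv | hv
  · exact mul_nonneg (hb v) (hcon v hv)
  · simp only [Pi.zero_apply] at hv
    simp [← hv]

/-- A quadratic function with leading term `-⟨x, x⟩` has finite sublevel sets. -/
theorem NegativeDefinite.finite_le (h : Γ.NegativeDefinite) (k : (V → ℤ) →ₗ[ℤ] ℤ) (N : ℤ) :
    {x | -Γ.form x x - k x ≤ N}.Finite := by
  obtain ⟨ε, hε, hle⟩ := h.exists_pos_le
  set C : ℝ := ∑ v, |(k (Pi.single v 1) : ℝ)| with hC
  set R : ℝ := max 1 ((C + |(N : ℝ)|) / ε) with hR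
  refine (Set.finite_Icc (fun _ : V => -⌈R⌉) (fun _ : V => ⌈R⌉)).subset fun x hx => ?_
  set z : V → ℝ := fun v => (x v : ℝ) with hz
  have hk : (k x : ℝ) ≤ C * ‖z‖ := by
    rw [linear_eq_sum k x, hC, Finset.sum_mul, Int.cast_sum]
    refine Finset.sum_le_sum fun v _ => ?_
    rw [Int.cast_mul]
    calc (x v : ℝ) * (k (Pi.single v 1) : ℝ) ≤ |(x v : ℝ) * (k (Pi.single v 1) : ℝ)| := le_abs_self _
      _ = |(k (Pi.single v 1) : ℝ)| * ‖z v‖ := by rw [abs_mul, mul_comm, Real.norm_eq_abs]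
      _ ≤ _ := mul_le_mul_of_nonneg_left (norm_le_pi_norm z v) (abs_nonneg _)
  have hxR : ((-Γ.form x x : ℤ) : ℝ) - k x ≤ N := by
    have := hx
    simp only [Set.mem_ofPred_eq] at this
    exact_mod_cast this
  have hzR : ‖z‖ ≤ R := by
    by_contra! hlt
    have h1 : 1 < ‖z‖ := (le_max_left _ _).trans_lt hlt
    have h2 : C + |(N : ℝ)| < ε * ‖z‖ := by
      have := (le_max_right _ _).trans_lt hlt
      rwa [div_lt_iff₀ hε, mul_comm] at this
    have h3 : ε * ‖z‖ ^ 2 ≤ C * ‖z‖ + |(N : ℝ)| := by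
      have := hle x
      have := le_abs_self (N : ℝ)
      linarith
    nlinarith [abs_nonneg (N : ℝ)]
  have hxv : ∀ v, |(x v : ℝ)| ≤ ⌈R⌉ := fun v =>
    (norm_le_pi_norm z v).trans (hzR.trans (Int.le_ceil R))
  refine ⟨fun v => ?_, fun v => ?_⟩
  · have := (abs_le.1 (hxv v)).1
    exact_mod_cast this
  · have := (abs_le.1 (hxv v)).2
    exact_mod_cast this

theorem NegativeDefinite.exists_forall_le (h : Γ.NegativeDefinite) (k : (V → ℤ) →ₗ[ℤ] ℤ)
    {A : Set (V → ℤ)} (hA : A.Nonempty) :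
    ∃ p ∈ A, ∀ q ∈ A, -Γ.form p p - k p ≤ -Γ.form q q - k q := by
  obtain ⟨a, ha⟩ := hA
  obtain ⟨p, hp, hmin⟩ := Set.exists_min_image {x | x ∈ A ∧ -Γ.form x x - k x ≤ -Γ.form a a - k a}
    (fun x => -Γ.form x x - k x) ((h.finite_le k _).subset fun x hx => hx.2) ⟨a, ha, le_rfl⟩
  refine ⟨p, hp.1, fun q hq => ?_⟩
  rcases le_total (-Γ.form q q - k q) (-Γ.form a a - k a) with hqa | hqa
  · exact hmin q ⟨hq, hqa⟩
  · exact hp.2.trans hqa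

/-! ### Finiteness and coordinates of Riemann–Roch functions -/

theorem IsCharacteristic.two_mul_chi_single (hk : Γ.IsCharacteristic k) (v : V) :
    2 * Γ.chi k (Pi.single v 1) = -(k (Pi.single v 1) + Γ.weight v) := by
  rw [hk.two_mul_chi, form_single_single, intersectionMatrix_self]

theorem NegativeDefinite.finite_chi_le (h : Γ.NegativeDefinite) (hk : Γ.IsCharacteristic k)
    (N : ℤ) : {x | Γ.chi k x ≤ N}.Finite := by
  refine (h.finite_le k (2 * N)).subset fun x hx => ?_
  have := hk.two_mul_chi x
  simp only [Set.mem_ofPred_eq] at hx ⊢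
  omega

theorem NegativeDefinite.bddBelow_chi (h : Γ.NegativeDefinite) (hk : Γ.IsCharacteristic k) :
    BddBelow (Set.range (Γ.chi k)) := by
  obtain ⟨p, -, hp⟩ := h.exists_forall_le k Set.univ_nonempty
  refine ⟨Γ.chi k p, ?_⟩
  rintro _ ⟨x, rfl⟩
  have h1 := hk.two_mul_chi x
  have h2 := hk.two_mul_chi p
  have := hp x trivial
  omega

theorem canonical_single (v : V) : Γ.canonical (Pi.single v 1) = -Γ.weight v - 2 := by
  simp [canonical_apply, Pi.single_apply]

theorem isCharacteristic_canonical : Γ.IsCharacteristic Γ.canonical := by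
  -- the parity of `k x + ⟨x, x⟩` is additive in `x`
  let S : AddSubgroup (V → ℤ) :=
    { carrier := {x | Even (Γ.canonical x + Γ.form x x)}
      zero_mem' := by simp
      add_mem' := by
        intro x y hx hy
        have e : Γ.canonical (x + y) + Γ.form (x + y) (x + y) =
            (Γ.canonical x + Γ.form x x) + (Γ.canonical y + Γ.form y y) + 2 * Γ.form x y := by
          rw [form_add_left, form_add_right, form_add_right, Γ.form_comm y x, map_add]
          ring
        rw [Set.mem_ofPred_eq, e]
        exact (hx.add hy).add (even_two_mul _)
      neg_mem' := by
        intro x hx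
        have e : Γ.canonical (-x) + Γ.form (-x) (-x) =
            (Γ.canonical x + Γ.form x x) - 2 * Γ.canonical x := by
          simp
          ring
        rw [Set.mem_ofPred_eq, e]
        exact hx.sub (even_two_mul _) }
  intro x
  change x ∈ S
  rw [pi_eq_sum_univ' x]
  refine S.sum_mem fun v _ => S.zsmul_mem ?_ _
  change Even _
  rw [canonical_single, form_single_single, intersectionMatrix_self]
  exact ⟨-1, by ring⟩

theorem chi_canonical_single (v : V) : Γ.chi Γ.canonical (Pi.single v 1) = 1 := by
  have := isCharacteristic_canonical (Γ := Γ).two_mul_chi_single v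
  rw [canonical_single] at this
  omega

end Form

section Combinatorics

variable {V : Type*} {Γ : PlumbingTree V}

/-! ### Leaves and reduced cycles -/

/-- On a finite nonempty set `T` of vertices of a tree, a vertex of `T` at maximal distance from a
root has at most one neighbour in `T`. -/
theorem exists_card_filter_adj_le_one {T : Finset V} (hT : T.Nonempty)
    [DecidableRel Γ.graph.Adj] : ∃ v ∈ T, (T.filter (Γ.graph.Adj v)).card ≤ 1 := by
  obtain ⟨r⟩ := Γ.isTree.connected.nonempty
  obtain ⟨v, hv, hmax⟩ := T.exists_max_image (Γ.graph.dist r) hT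
  refine ⟨v, hv, Finset.card_le_one.2 ?_⟩
  have key : ∀ u ∈ T, Γ.graph.Adj v u →
      ∃ p : Γ.graph.Walk r v, p.IsPath ∧ p.penultimate = u := by
    intro u hu hvu
    have hd : Γ.graph.dist r v = Γ.graph.dist r u + 1 := by
      have := hmax u hu
      rcases Γ.isTree.dist_eq_dist_add_one_of_adj r hvu with h | h <;> omega
    obtain ⟨p, -, hp⟩ := (Γ.isTree.connected r u).exists_path_of_dist
    refine ⟨p.concat hvu.symm, ?_, p.penultimate_concat _⟩
    refine SimpleGraph.Walk.isPath_of_length_eq_dist _ ?_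
    rw [SimpleGraph.Walk.length_concat, hp, hd]
  intro a ha b hb
  rw [Finset.mem_filter] at ha hb
  obtain ⟨p, hp, rfl⟩ := key a ha.1 ha.2
  obtain ⟨p', hp', rfl⟩ := key b hb.1 hb.2
  have := (Γ.isTree.isAcyclic.subsingleton_path r v).elim ⟨p, hp⟩ ⟨p', hp'⟩
  rw [Subtype.mk.injEq] at this
  rw [this]

/-- The reduced cycle `∑ v ∈ T, E_v`. -/
def reducedCycle [DecidableEq V] (T : Finset V) : V → ℤ := fun v => if v ∈ T then 1 else 0

theorem reducedCycle_nonneg [DecidableEq V] (T : Finset V) : 0 ≤ reducedCycle T := fun v => by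
  simp only [reducedCycle, Pi.zero_apply]
  split_ifs <;> simp

theorem reducedCycle_insert [DecidableEq V] {T : Finset V} {v : V} (hv : v ∉ T) :
    reducedCycle (insert v T) = reducedCycle T + Pi.single v 1 := by
  ext u
  simp only [reducedCycle, Finset.mem_insert, Pi.add_apply, Pi.single_apply]
  grind

theorem reducedCycle_empty [DecidableEq V] : reducedCycle (∅ : Finset V) = 0 := by
  ext; simp [reducedCycle]

variable [Fintype V] [DecidableEq V]

open Classical in
theorem form_reducedCycle_single (T : Finset V) (v : V) :
    Γ.form (reducedCycle T) (Pi.single v 1) =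
      (T.filter (Γ.graph.Adj v)).card + if v ∈ T then Γ.weight v else 0 := by
  have h : ∀ u, (if u ∈ T then (1 : ℤ) else 0) * Γ.intersectionMatrix u v =
      (if u ∈ T.filter (Γ.graph.Adj v) then 1 else 0) +
        if u = v then (if v ∈ T then Γ.weight v else 0) else 0 := by
    intro u
    rcases eq_or_ne u v with rfl | hne
    · simp [intersectionMatrix_self]
    · rw [Γ.intersectionMatrix_of_ne hne, Γ.graph.adj_comm]
      simp only [Finset.mem_filter, hne, if_false]
      split_ifs <;> simp_all
  simp only [form_single_right, reducedCycle, h, Finset.sum_add_distrib, Finset.sum_ite_eq',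
    Finset.mem_univ, if_true, Finset.sum_ite_mem, Finset.univ_inter, Finset.sum_const,
    nsmul_eq_mul, mul_one]

theorem form_reducedCycle_univ (hΓ : Γ.NegativeDefinite) (v : V) :
    Γ.form (reducedCycle Finset.univ) (Pi.single v 1) = Γ.deficiency v := by
  classical
  rw [form_reducedCycle_single, deficiency, abs_of_neg (hΓ.weight_neg v),
    if_pos (Finset.mem_univ v), sub_neg_eq_add, Set.ncard_eq_toFinset_card']
  congr 3
  ext u
  simp

/-- By adjunction `χ_K` of a reduced cycle is the number of components of its support, since a tree
has no cycles. Here leaves are removed one by one. -/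
theorem one_le_chi_reducedCycle {T : Finset V} (hT : T.Nonempty) :
    1 ≤ Γ.chi Γ.canonical (reducedCycle T) := by
  classical
  induction hn : T.card generalizing T with
  | zero => exact absurd (Finset.card_eq_zero.1 hn) hT.ne_empty
  | succ n ih =>
    obtain ⟨v, hv, hcard⟩ := Γ.exists_card_filter_adj_le_one hT
    have hv' : v ∉ T.erase v := Finset.notMem_erase v T
    have hle : ((T.erase v).filter (Γ.graph.Adj v)).card ≤ 1 :=
      (Finset.card_le_card (Finset.filter_subset_filter _ (Finset.erase_subset v T))).trans hcard
    rw [← Finset.insert_erase hv, reducedCycle_insert hv',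
      isCharacteristic_canonical.chi_add, chi_canonical_single, form_reducedCycle_single,
      if_neg hv', add_zero]
    rcases (T.erase v).eq_empty_or_nonempty with he | he
    · rw [he, reducedCycle_empty, chi_zero]
      simp
    · have := ih he (by rw [Finset.card_erase_of_mem hv, hn, Nat.add_sub_cancel])
      omega

theorem chi_reducedCycle_univ : Γ.chi Γ.canonical (reducedCycle Finset.univ) = 1 := by
  classical
  have h := isCharacteristic_canonical (Γ := Γ).two_mul_chi (reducedCycle Finset.univ)
  have hdeg := Γ.graph.sum_degrees_eq_twice_card_edges
  have hcard := Γ.isTree.card_edgeFinset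
  have hform : Γ.form (reducedCycle Finset.univ) (reducedCycle Finset.univ) =
      ((∑ v, Γ.graph.degree v : ℕ) : ℤ) + ∑ v, Γ.weight v := by
    rw [form_eq_sum, Nat.cast_sum, ← Finset.sum_add_distrib]
    refine Finset.sum_congr rfl fun v _ => ?_
    rw [form_reducedCycle_single, if_pos (Finset.mem_univ v), ← SimpleGraph.card_neighborFinset_eq_degree,
      SimpleGraph.neighborFinset_eq_filter]
    simp [reducedCycle]
  have hK : Γ.canonical (reducedCycle Finset.univ) = -(∑ v, Γ.weight v) - 2 * Fintype.card V := by
    rw [canonical_apply]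
    simp [reducedCycle, Finset.sum_sub_distrib, mul_comm]
  rw [hform, hK, hdeg] at h
  push_cast at h
  omega

/-! ### Anti-effective cycles -/

/-- `χ_K ≥ 0` on anti-effective cycles: one may remove from `b ≥ 0` some `E_v` with
`⟨b, E_v⟩ < 0` without increasing `χ_K(-b)`. -/
theorem NegativeDefinite.chi_canonical_neg_nonneg (hΓ : Γ.NegativeDefinite) {b : V → ℤ}
    (hb : 0 ≤ b) : 0 ≤ Γ.chi Γ.canonical (-b) := by
  induction hn : (∑ v, b v).toNat using Nat.strong_induction_on generalizing b with
  | _ n ih =>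
  by_cases hb0 : b = 0
  · rw [hb0, neg_zero, chi_zero]
  obtain ⟨v, hv, hform⟩ := hΓ.exists_form_neg hb hb0
  have hb' : 0 ≤ b - Pi.single v 1 := fun u => by
    have := hb u
    simp only [Pi.sub_apply, Pi.single_apply, Pi.zero_apply] at this ⊢
    grind
  have hsum : ∑ u, (b - Pi.single v 1 : V → ℤ) u = ∑ u, b u - 1 := by
    simp [Finset.sum_sub_distrib]
  have hpos : 0 ≤ ∑ u, (b - Pi.single v 1 : V → ℤ) u := Finset.sum_nonneg fun u _ => hb' u
  have h1 := ih _ (by rw [hsum] at hpos ⊢; omega) hb' rfl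
  have h2 := (isCharacteristic_canonical (Γ := Γ)).chi_add (-b) (Pi.single v 1)
  rw [show -b + Pi.single v 1 = -(b - Pi.single v 1) by abel, chi_canonical_single,
    form_neg_left] at h2
  omega

end Combinatorics

/-! ### Proper `E₈` subgraphs and very bad vertices -/

/-- The multiplicities of the fundamental cycle of `E₈`. -/
def e8Mult : Fin 8 → ℤ := ![2, 3, 4, 5, 6, 4, 2, 3]

/-- The intersection matrix of `E₈`. -/
def e8Matrix (i j : Fin 8) : ℤ :=
  if i = j then -2 else
    if s(i, j) ∈ [s(0, 1), s(1, 2), s(2, 3), s(3, 4), s(4, 5), s(5, 6), s(4, 7)] then 1 else 0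

theorem e8Matrix_le {V : Type*} {Γ : PlumbingTree V} {f : e8Graph →g Γ.graph} (hf : Function.Injective f)
    (hw : ∀ i, Γ.weight (f i) = -2) (i j : Fin 8) :
    e8Matrix i j ≤ Γ.intersectionMatrix (f i) (f j) := by
  rw [e8Matrix]
  split_ifs with h1 h2
  · rw [h1, intersectionMatrix_self, hw]
  · refine (Γ.intersectionMatrix_of_adj (f.map_adj ?_)).ge
    rw [e8Graph, SimpleGraph.fromEdgeSet_adj]
    refine ⟨?_, h1⟩
    simpa using h2
  · exact Γ.intersectionMatrix_nonneg (hf.ne h1)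

section LSpace

variable {V : Type*} [Fintype V] [LinearOrder V] {Γ : PlumbingTree V}

/-- If `χ_K(x) ≤ 0` for some nonzero effective cycle `x`, then `Γ` is not an L-space: no edge of the
sublevel set of `χ_K` at height zero joins the orthant of anti-effective cycles, which contains `0`,
to its complement, which contains `x`. -/
theorem NegativeDefinite.not_isLatticeLSpace (hΓ : Γ.NegativeDefinite) {x : V → ℤ} (hx : 0 ≤ x)
    (hx0 : x ≠ 0) (hchi : Γ.chi Γ.canonical x ≤ 0) : ¬ Γ.IsLatticeLSpace := by
  intro hL
  have hK := isCharacteristic_canonical (Γ := Γ)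
  refine LatticeCohomology.not_subsingleton_reduced_zero (hΓ.finite_chi_le hK 0)
    (hΓ.bddBelow_chi hK) {l | l ≤ 0} (a := 0) (b := x) (le_refl (0 : V → ℤ))
    (fun h => hx0 (le_antisymm h hx)) chi_zero.le hchi ?_ (hL _ hK 0)
  intro l v _ h1
  refine ⟨fun hl => ?_, fun hl => ?_⟩
  · by_contra hcon
    have hl : 0 ≤ -l := neg_nonneg.2 hl
    have hv : l v = 0 := by
      by_contra hne
      refine hcon fun u => ?_
      have := hl u
      have := hl v
      simp only [Pi.neg_apply, Pi.zero_apply, Pi.add_apply, Pi.single_apply] at *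
      grind
    have h2 := hK.chi_add l (Pi.single v 1)
    have h3 := hΓ.chi_canonical_neg_nonneg hl
    have h4 := Γ.form_single_nonneg hl (v := v) (by simp [hv])
    rw [form_neg_left] at h4
    rw [neg_neg] at h3
    rw [chi_canonical_single] at h2
    omega
  · exact (le_add_of_nonneg_right (Pi.single_nonneg.2 zero_le_one)).trans (show l + Pi.single v 1 ≤ 0 from hl)

theorem NegativeDefinite.not_isLatticeLSpace_of_isVeryBad (hΓ : Γ.NegativeDefinite) {v : V}
    (hv : Γ.IsVeryBad v) : ¬ Γ.IsLatticeLSpace := by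
  have hE : (0 : V → ℤ) ≤ Pi.single v 1 := Pi.single_nonneg.2 zero_le_one
  refine hΓ.not_isLatticeLSpace (x := reducedCycle Finset.univ + Pi.single v 1)
    (add_nonneg (reducedCycle_nonneg _) hE) (fun h => ?_) ?_
  · have := congrFun h v
    simp [reducedCycle] at this
  · rw [isCharacteristic_canonical.chi_add, chi_canonical_single, chi_reducedCycle_univ,
      form_reducedCycle_univ hΓ]
    have : 2 ≤ Γ.deficiency v := hv
    omega

theorem NegativeDefinite.not_isLatticeLSpace_of_containsProperE8 (hΓ : Γ.NegativeDefinite)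
    (hE : Γ.ContainsProperE8) : ¬ Γ.IsLatticeLSpace := by
  obtain ⟨f, hf, hw, hsurj⟩ := hE
  have hK := isCharacteristic_canonical (Γ := Γ)
  -- a vertex `u` outside the copy of `E₈`, adjacent to a vertex `f i` of the copy
  obtain ⟨i, u, hu, hadj⟩ : ∃ i u, u ∉ Set.range f ∧ Γ.graph.Adj (f i) u := by
    rw [Function.Surjective, not_forall] at hsurj
    obtain ⟨y, hy⟩ := hsurj
    obtain ⟨p⟩ := Γ.isTree.connected (f 0) y
    obtain ⟨d, -, ⟨i, hi⟩, hd⟩ := p.exists_boundary_dart (Set.range f) ⟨0, rfl⟩ hy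
    exact ⟨i, d.snd, hd, hi ▸ d.adj⟩
  set z : V → ℤ := ∑ i, e8Mult i • Pi.single (f i) 1 with hz
  have hmult : ∀ i, 2 ≤ e8Mult i := by decide
  have hz0 : 0 ≤ z := Finset.sum_nonneg fun i _ =>
    smul_nonneg ((zero_le_two).trans (hmult i)) (Pi.single_nonneg.2 zero_le_one)
  have hKz : Γ.canonical z = 0 := by
    rw [hz, map_sum]
    refine Finset.sum_eq_zero fun i _ => ?_
    rw [map_smul, canonical_single, hw]
    simp
  have hform : -2 ≤ Γ.form z z := by
    have h1 : Γ.form z z = ∑ j, e8Mult j * ∑ i, e8Mult i * Γ.intersectionMatrix (f i) (f j) := by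
      conv_lhs => rw [hz]
      rw [form_sum_smul_single]
      refine Finset.sum_congr rfl fun j _ => ?_
      rw [Γ.form_comm, form_sum_smul_single]
      simp only [form_single_single, Γ.intersectionMatrix_comm (f j)]
    have h2 : (-2 : ℤ) = ∑ j, e8Mult j * ∑ i, e8Mult i * e8Matrix i j := by decide
    rw [h1, h2]
    refine Finset.sum_le_sum fun j _ => ?_
    refine mul_le_mul_of_nonneg_left (Finset.sum_le_sum fun i _ => ?_)
      ((zero_le_two).trans (hmult j))
    exact mul_le_mul_of_nonneg_left (e8Matrix_le hf hw i j) ((zero_le_two).trans (hmult i))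
  have hzu : 2 ≤ Γ.form z (Pi.single u 1) := by
    rw [Γ.form_comm, hz, form_sum_smul_single]
    simp only [form_single_single, Γ.intersectionMatrix_comm u]
    have hnn : ∀ j ∈ Finset.univ, 0 ≤ e8Mult j * Γ.intersectionMatrix (f j) u := fun j _ =>
      mul_nonneg ((zero_le_two).trans (hmult j))
        (Γ.intersectionMatrix_nonneg fun h => hu ⟨j, h⟩)
    refine le_trans ?_ (Finset.single_le_sum hnn (Finset.mem_univ i))
    rw [Γ.intersectionMatrix_of_adj hadj, mul_one]
    exact hmult i
  refine hΓ.not_isLatticeLSpace (x := z + Pi.single u 1)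
    (add_nonneg hz0 (Pi.single_nonneg.2 zero_le_one)) (fun h => ?_) ?_
  · have h1 := congrFun h u
    have h2 := hz0 u
    simp only [Pi.add_apply, Pi.single_eq_same, Pi.zero_apply] at h1 h2
    omega
  · have h1 := hK.two_mul_chi z
    rw [hK.chi_add, chi_canonical_single]
    omega

end LSpace

section Rational

variable {V : Type*} [Fintype V] [DecidableEq V] {Γ : PlumbingTree V}

/-! ### Insulated trees are rational -/

open Classical in
/-- The cycle with multiplicity two at the bad vertices and one at the good ones is anti-nef; it is
the fundamental cycle of an insulated tree. -/
theorem IsInsulated.form_add_reducedCycle_nonpos (h : Γ.IsInsulated) (v : V) :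
    Γ.form (reducedCycle Finset.univ + reducedCycle (Finset.univ.filter Γ.IsBad))
      (Pi.single v 1) ≤ 0 := by
  rw [form_add_left, form_reducedCycle_univ h.negativeDefinite, form_reducedCycle_single]
  by_cases hv : Γ.IsBad v
  · have h0 : (Finset.univ.filter Γ.IsBad).filter (Γ.graph.Adj v) = ∅ := by
      refine Finset.filter_eq_empty_iff.2 fun u hu => h.bad v u hv ?_
      exact (Finset.mem_filter.1 hu).2
    have h1 : ¬ 2 ≤ Γ.deficiency v := h.not_veryBad v
    have h2 := h.negativeDefinite.weight_neg v
    rw [h0, if_pos (by simp [hv]), Finset.card_empty]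
    push_cast
    omega
  · have hg : Γ.IsGood v := by
      have : ¬ 1 ≤ Γ.deficiency v := hv
      rw [IsGood]
      omega
    have h1 := h.good v hg
    have h2 : ((Finset.univ.filter Γ.IsBad).filter (Γ.graph.Adj v)).card =
        Γ.badNeighbours v := by
      rw [badNeighbours, Set.ncard_eq_toFinset_card']
      congr 1
      ext u
      simp [and_comm]
    rw [h2, if_neg (by simp [hv])]
    omega

/-- `χ_K ≥ 1` on the nonzero cycles between zero and the fundamental cycle: adding to a reduced
cycle `∑ v ∈ T, E_v` a further `E_v` for pairwise non-adjacent vertices `v ∈ T` with `d(v) ≤ 1` does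
not decrease `χ_K`. -/
theorem IsInsulated.one_le_chi_add_reducedCycle (h : Γ.IsInsulated) {T : Finset V}
    (hT : T.Nonempty) (B : Finset V) (hBT : B ⊆ T) (hB : ∀ v ∈ B, Γ.IsBad v) :
    1 ≤ Γ.chi Γ.canonical (reducedCycle T + reducedCycle B) := by
  classical
  induction B using Finset.induction_on with
  | empty => simpa [reducedCycle_empty] using one_le_chi_reducedCycle hT
  | insert v B hv ih =>
    have hvT : v ∈ T := hBT (Finset.mem_insert_self v B)
    have hvb : Γ.IsBad v := hB v (Finset.mem_insert_self v B)
    have ih := ih ((Finset.subset_insert v B).trans hBT)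
      fun u hu => hB u (Finset.mem_insert_of_mem hu)
    have h0 : B.filter (Γ.graph.Adj v) = ∅ :=
      Finset.filter_eq_empty_iff.2 fun u hu => h.bad v u hvb (hB u (Finset.mem_insert_of_mem hu))
    have h1 : Γ.form (reducedCycle T) (Pi.single v 1) ≤ Γ.deficiency v := by
      rw [← form_reducedCycle_univ h.negativeDefinite]
      refine Γ.form_single_mono (fun u => ?_) (by simp [reducedCycle, hvT])
      simp only [reducedCycle, Finset.mem_univ, if_true]
      split_ifs <;> simp
    have h2 : ¬ 2 ≤ Γ.deficiency v := h.not_veryBad v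
    rw [reducedCycle_insert hv, ← add_assoc, isCharacteristic_canonical.chi_add,
      chi_canonical_single, form_add_left, form_reducedCycle_single B, h0, if_neg hv,
      Finset.card_empty]
    push_cast
    omega

/-- Insulated trees are rational: `χ_K(x) ≥ 1` for every nonzero effective cycle `x`.  With `Z` the
fundamental cycle, `x` is the sum of `min(x, Z)` and the smaller effective cycle
`(x - Z)⁺`, and the two have nonpositive intersection number. -/
theorem IsInsulated.one_le_chi_canonical (h : Γ.IsInsulated) {x : V → ℤ} (hx : 0 ≤ x)
    (hx0 : x ≠ 0) : 1 ≤ Γ.chi Γ.canonical x := by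
  classical
  induction hn : (∑ v, x v).toNat using Nat.strong_induction_on generalizing x with
  | _ n ih =>
  set Z : V → ℤ := reducedCycle Finset.univ + reducedCycle (Finset.univ.filter Γ.IsBad) with hZ
  have hZv : ∀ v, Z v = 1 + if Γ.IsBad v then 1 else 0 := by
    intro v; simp [hZ, reducedCycle]
  set T := Finset.univ.filter fun v => 1 ≤ x v with hT
  set B := Finset.univ.filter fun v => Γ.IsBad v ∧ 2 ≤ x v with hB
  set m : V → ℤ := reducedCycle T + reducedCycle B with hm
  have hmv : ∀ v, m v = min (x v) (Z v) := by
    intro v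
    have := hx v
    simp only [Pi.zero_apply] at this
    simp only [hm, hT, hB, hZv, reducedCycle, Pi.add_apply, Finset.mem_filter, Finset.mem_univ,
      true_and]
    by_cases hbad : Γ.IsBad v <;> simp only [hbad, true_and, false_and, if_true, if_false] <;>
      split_ifs <;> omega
  obtain ⟨v₀, hv₀⟩ : ∃ v, 1 ≤ x v := by
    by_contra! hcon
    exact hx0 (le_antisymm (fun v => by have := hcon v; simp only [Pi.zero_apply]; omega) hx)
  have hchim : 1 ≤ Γ.chi Γ.canonical m :=
    h.one_le_chi_add_reducedCycle ⟨v₀, by simp [hT, hv₀]⟩ B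
      (fun v hv => by simp only [hB, hT, Finset.mem_filter, Finset.mem_univ, true_and] at hv ⊢; omega)
      (fun v hv => (Finset.mem_filter.1 hv).2.1)
  have hm0 : 0 ≤ m := add_nonneg (reducedCycle_nonneg T) (reducedCycle_nonneg B)
  set α : V → ℤ := x - m with hα
  have hα0 : 0 ≤ α := fun v => by
    simp only [hα, Pi.sub_apply, hmv, Pi.zero_apply]
    omega
  have hβ0 : 0 ≤ Z - m := fun v => by
    simp only [Pi.sub_apply, hmv, Pi.zero_apply]
    omega
  have hdisj : ∀ v, (Z - m) v = 0 ∨ α v = 0 := fun v => by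
    simp only [hα, Pi.sub_apply, hmv]
    omega
  have hformZ : Γ.form Z α ≤ 0 := by
    rw [form_eq_sum]
    exact Finset.sum_nonpos fun v _ =>
      mul_nonpos_of_nonneg_of_nonpos (hα0 v) (h.form_add_reducedCycle_nonpos v)
  have hformm := Γ.form_nonneg_of_disjoint hβ0 hα0 hdisj
  rw [form_sub_left] at hformm
  have hchiα : 0 ≤ Γ.chi Γ.canonical α := by
    by_cases hα00 : α = 0
    · rw [hα00, chi_zero]
    have hsum : ∑ v, α v < ∑ v, x v := by
      refine Finset.sum_lt_sum (fun v _ => ?_) ⟨v₀, Finset.mem_univ _, ?_⟩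
      · have := hm0 v
        simp only [hα, Pi.sub_apply, Pi.zero_apply] at this ⊢
        omega
      · have : 1 ≤ Z v₀ := by rw [hZv]; split_ifs <;> omega
        simp only [hα, Pi.sub_apply, hmv]
        omega
    have hnn : 0 ≤ ∑ v, α v := Finset.sum_nonneg fun v _ => hα0 v
    exact zero_le_one.trans (ih _ (by omega) hα0 hα00 rfl)
  have hxm : x = m + α := by rw [hα]; abel
  rw [hxm, isCharacteristic_canonical.chi_add]
  omega

/-- In a rational tree every nonzero effective cycle `a` has a component `E_v` with
`χ_K(a - E_v) ≤ χ_K(a)`. -/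
theorem exists_form_sub_single_le_one
    (hrat : ∀ x : V → ℤ, 0 ≤ x → x ≠ 0 → 1 ≤ Γ.chi Γ.canonical x) {a : V → ℤ} (ha : 0 ≤ a)
    (ha0 : a ≠ 0) : ∃ v, 0 < a v ∧ Γ.form (a - Pi.single v 1) (Pi.single v 1) ≤ 1 := by
  by_contra! hcon
  have h1 := hrat a ha ha0
  have h2 := (isCharacteristic_canonical (Γ := Γ)).two_mul_chi a
  rw [canonical_apply, form_eq_sum, ← Finset.sum_add_distrib] at h2
  have h3 : 0 ≤ ∑ v, (a v * (-Γ.weight v - 2) + a v * Γ.form a (Pi.single v 1)) := by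
    refine Finset.sum_nonneg fun v _ => ?_
    rw [← mul_add]
    rcases (ha v).lt_or_eq with hv | hv
    · have := hcon v hv
      rw [form_sub_left, form_single_single, intersectionMatrix_self] at this
      exact mul_nonneg (ha v) (by omega)
    · simp only [Pi.zero_apply] at hv
      simp [← hv]
  omega

/-! ### Rational trees are L-spaces -/

/-- There is a lattice point `p` minimal among those with `⟨p, E_v⟩ < c v` for all `v`.  For
`c v = χ_k(E_v)` the condition is that `χ_k(p) < χ_k(p + E_v)`, and the second property says that
`χ_k(p - b + E_v) ≤ χ_k(p - b)` for some component `E_v` of `b`. -/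
theorem NegativeDefinite.exists_center (hΓ : Γ.NegativeDefinite) (c : V → ℤ) :
    ∃ p : V → ℤ, (∀ v, Γ.form p (Pi.single v 1) + 1 ≤ c v) ∧
      ∀ b : V → ℤ, 0 ≤ b → b ≠ 0 →
        ∃ v, 0 < b v ∧ c v ≤ Γ.form (p - b) (Pi.single v 1) := by
  have hlin : ∀ d x : V → ℤ, (∑ v, d v • LinearMap.proj v : (V → ℤ) →ₗ[ℤ] ℤ) x
      = ∑ v, d v * x v := by
    intro d x; simp
  set A : Set (V → ℤ) := {p | ∀ v, Γ.form p (Pi.single v 1) + 1 ≤ c v} with hA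
  have hne : A.Nonempty := by
    -- at a minimum of this function its increments `2 (c v - 1 - ⟨p, E_v⟩)` are nonnegative
    obtain ⟨p, -, hp⟩ := hΓ.exists_forall_le
      (∑ v, (-Γ.weight v - 2 * (c v - 1)) • LinearMap.proj v) (Set.univ_nonempty (α := V → ℤ))
    refine ⟨p, fun v => ?_⟩
    have h1 := hp (p + Pi.single v 1) trivial
    simp only [map_add, form_add_left, form_add_right, form_single_single,
      intersectionMatrix_self, Γ.form_comm (Pi.single v 1) p] at h1
    rw [hlin _ (Pi.single v 1)] at h1
    simp only [Pi.single_apply, mul_ite, mul_one, mul_zero, Finset.sum_ite_eq', Finset.mem_univ,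
      if_true] at h1
    omega
  -- the function `-⟨x, x⟩ + 2 ∑ c v x v` decreases strictly on passing to a smaller element of `A`
  obtain ⟨p, hp, hmin⟩ := hΓ.exists_forall_le (∑ v, (-2 * c v) • LinearMap.proj v) hne
  refine ⟨p, hp, fun b hb hb0 => ?_⟩
  by_contra! hcon
  have hq : p - b ∈ A := by
    intro v
    rcases (hb v).lt_or_eq with hv | hv
    · exact hcon v hv
    · have := Γ.form_single_nonneg hb (v := v) hv.symm
      have := hp v
      rw [form_sub_left]
      omega
  have h1 := hmin _ hq
  rw [map_sub, hlin, hlin] at h1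
  have h2 : 0 < ∑ v, b v * ((c v - Γ.form p (Pi.single v 1)) +
      (c v - Γ.form (p - b) (Pi.single v 1))) := by
    obtain ⟨v₀, hv₀⟩ : ∃ v, 0 < b v := by
      by_contra! hle
      exact hb0 (le_antisymm hle hb)
    refine Finset.sum_pos' (fun v _ => mul_nonneg (hb v) ?_) ⟨v₀, Finset.mem_univ _,
      mul_pos hv₀ ?_⟩
    · have := hp v; have := hq v; omega
    · have := hp v₀; have := hq v₀; omega
  have h3 : ∑ v, b v * ((c v - Γ.form p (Pi.single v 1)) +
      (c v - Γ.form (p - b) (Pi.single v 1))) =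
      -∑ v, -2 * c v * b v - Γ.form p b - Γ.form (p - b) b := by
    rw [Γ.form_eq_sum p b, Γ.form_eq_sum (p - b) b, ← Finset.sum_neg_distrib,
      ← Finset.sum_sub_distrib, ← Finset.sum_sub_distrib]
    exact Finset.sum_congr rfl fun v _ => by ring
  have h4 : Γ.form (p - b) (p - b) = Γ.form p p - Γ.form p b - Γ.form (p - b) b := by
    have e : Γ.form (p - b) p = Γ.form p p - Γ.form p b := by
      rw [form_sub_left, Γ.form_comm b p]
    have e' : Γ.form (p - b) (p - b) + Γ.form (p - b) b = Γ.form (p - b) p := by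
      rw [← form_add_right, sub_add_cancel]
    omega
  omega

end Rational

section LSpace

variable {V : Type*} [Fintype V] [LinearOrder V] {Γ : PlumbingTree V}

/-- In a rational tree, every sublevel set of every `χ_k` contracts to a point `p`: going up from
`p`, rationality provides the direction of the next layer; going down, the minimality of `p`
does. -/
theorem exists_collapses (hΓ : Γ.NegativeDefinite)
    (hrat : ∀ x : V → ℤ, 0 ≤ x → x ≠ 0 → 1 ≤ Γ.chi Γ.canonical x)
    {k : (V → ℤ) →ₗ[ℤ] ℤ} (hk : Γ.IsCharacteristic k) :
    ∃ p, ∀ lo hi, lo ≤ p → p ≤ hi → LatticeCohomology.Collapses (Γ.chi k) p lo hi := by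
  obtain ⟨p, hp1, hp2⟩ := hΓ.exists_center fun v => Γ.chi k (Pi.single v 1)
  have hsub : ∀ {a : V → ℤ} {v : V}, 0 ≤ a → 0 < a v → 0 ≤ a - Pi.single v 1 ∧
      (∑ u, (a - Pi.single v 1 : V → ℤ) u).toNat < (∑ u, a u).toNat := by
    intro a v ha hv
    have ha' : 0 ≤ a - Pi.single v 1 := fun u => by
      have := ha u
      simp only [Pi.sub_apply, Pi.single_apply, Pi.zero_apply] at this ⊢
      grind
    have hsum : ∑ u, (a - Pi.single v 1 : V → ℤ) u = ∑ u, a u - 1 := by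
      simp [Finset.sum_sub_distrib]
    have hpos : 0 ≤ ∑ u, (a - Pi.single v 1 : V → ℤ) u := Finset.sum_nonneg fun u _ => ha' u
    exact ⟨ha', by omega⟩
  have hup : ∀ a : V → ℤ, 0 ≤ a → LatticeCohomology.Collapses (Γ.chi k) p p (p + a) := by
    intro a ha
    induction hn : (∑ u, a u).toNat using Nat.strong_induction_on generalizing a with
    | _ n ih =>
    by_cases ha0 : a = 0
    · rw [ha0, add_zero]
      exact .point
    obtain ⟨v, hv, hform⟩ := exists_form_sub_single_le_one hrat ha ha0
    obtain ⟨ha', hlt⟩ := hsub ha hv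
    have hc := ih _ (hn ▸ hlt) _ ha' rfl
    have e : p + a = p + (a - Pi.single v 1) + Pi.single v 1 := by abel
    rw [e]
    refine hc.up v fun l hl hlv => ?_
    have h1 := Γ.form_single_mono hl.2 hlv
    have h2 := hp1 v
    rw [form_add_left] at h1
    rw [hk.chi_add]
    omega
  have hdown : ∀ a b : V → ℤ, 0 ≤ a → 0 ≤ b →
      LatticeCohomology.Collapses (Γ.chi k) p (p - b) (p + a) := by
    intro a b ha hb
    induction hn : (∑ u, b u).toNat using Nat.strong_induction_on generalizing b with
    | _ n ih =>
    by_cases hb0 : b = 0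
    · rw [hb0, sub_zero]
      exact hup a ha
    obtain ⟨v, hv, hform⟩ := hp2 b hb hb0
    obtain ⟨hb', hlt⟩ := hsub hb hv
    have hc := ih _ (hn ▸ hlt) _ hb' rfl
    have e : p - b = p - (b - Pi.single v 1) - Pi.single v 1 := by abel
    rw [e] at hform ⊢
    refine hc.down v fun l hl hlv => ?_
    have h1 := Γ.form_single_mono (x := p - (b - Pi.single v 1) - Pi.single v 1)
      (y := l - Pi.single v 1) (sub_le_sub_right hl.1 _) (v := v) (by simp [hlv])
    have h2 := hk.chi_add (l - Pi.single v 1) (Pi.single v 1)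
    rw [sub_add_cancel] at h2
    omega
  refine ⟨p, fun lo hi hlo hhi => ?_⟩
  simpa using hdown (hi - p) (p - lo) (sub_nonneg.2 hhi) (sub_nonneg.2 hlo)

theorem IsInsulated.isLatticeLSpace (h : Γ.IsInsulated) : Γ.IsLatticeLSpace := by
  intro k hk q
  obtain ⟨p, hp⟩ := exists_collapses h.negativeDefinite
    (fun x hx hx0 => h.one_le_chi_canonical hx hx0) hk
  exact LatticeCohomology.subsingleton_reduced_of_collapses
    (h.negativeDefinite.finite_chi_le hk) hp q

end LSpace

end PlumbingTree

theorem mainTheorem4 {V : Type*} [Fintype V] [LinearOrder V] (Γ : PlumbingTree V)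
    (hΓ : Γ.NegativeDefinite) :
    ((∃ v, Γ.IsVeryBad v) → ¬ Γ.IsLatticeLSpace) ∧
    (Γ.ContainsProperE8 → ¬ Γ.IsLatticeLSpace) ∧
    (Γ.IsInsulated → Γ.IsLatticeLSpace) :=
  ⟨fun ⟨_, hv⟩ => hΓ.not_isLatticeLSpace_of_isVeryBad hv,
    hΓ.not_isLatticeLSpace_of_containsProperE8, fun h => h.isLatticeLSpace⟩
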